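/- A square packing is a finite or countable collection $\mathcal S$ of closed squares in $\mathbb R^2$, of positive side length, with sides parallel to the coordinate axes and with pairwise disjoint interiors. Two distinct squares of $\mathcal S$ are adjacent if they intersect (so squares touching only at a corner are adjacent); this defines a graph $G_{\mathcal S}$. For $p\in[0,1]$, let each square be open (white) with probability $p$, independently, and let $G^p_{\mathcal S}$ be the subgraph of $G_{\mathcal S}$ induced on the open squares. Let $d(s,t)=\min\{\|x-y\|_\infty : x\in s,\ y\in t\}$ and let $\operatorname{diam}$ be the diameter with respect to $\|\cdot\|_\infty$. Call $p\in(0,1]$ a percolation constant for square packings if for every square packing $\mathcal S$ and every $s_0\in\mathcal S$: (a) the probability that there is an infinite path $s_0,s_1,s_2,\dots$ in $G^p_{\mathcal S}$ (consecutive squares adjacent, all squares open, including $s_0$) with $d(s_0,s_n)\to\infty$ is zero; (b) if $D:=\sup_{s\in\mathcal S}\operatorname{diam}(s)<\infty$, then for each $r>0$ the probability that $s_0$ is connected in $G^p_{\mathcal S}$ to some $s\in\mathcal S$ with $d(s_0,s)\ge r$ is at most $e^{-r/D}$. Corollary 2.6. Percolation constants for square packings exist, and there is $c>0$ with the following property.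 Let $p$ be any percolation constant for square packings. Let $\mathcal S$ be a finite square packing all of whose squares are contained in the unit square $[0,1]^2$, and colour each square of $\mathcal S$ white with probability $p$, independently. Then the probability of a white top-bottom crossing, i.e. of a path in $G^p_{\mathcal S}$ from a square meeting the side $[0,1]\times\{1\}$ to a square meeting the side $[0,1]\times\{0\}$ (diagonal connectivity through shared corners allowed), is at most $1-c$. -/

import Mathlib

/-! Site percolation on packings of squares in the plane `Fin 2 → ℝ`. The norm, the distance and
the diameter (`Metric.diam`) of `Fin 2 → ℝ` in Mathlib are those of the `ℓ^∞` norm. -/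

namespace SquarePercolation

/-- A closed square of positive side length with sides parallel to the coordinate axes. -/
def IsSquare (s : Set (Fin 2 → ℝ)) : Prop :=
  ∃ (a : Fin 2 → ℝ) (l : ℝ), 0 < l ∧ s = Set.Icc a (fun i => a i + l)

/-- A square packing: a finite or countable collection of squares with disjoint interiors. -/
structure IsSquarePacking (S : Set (Set (Fin 2 → ℝ))) : Prop where
  countable : S.Countable
  isSquare : ∀ s ∈ S, IsSquare s
  disjoint_interior : S.Pairwise fun s t => Disjoint (interior s) (interior t)

/-- The graph of a collection of sets: two distinct sets are adjacent when they intersect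
(so two squares that meet only at a corner are adjacent). -/
def packingGraph (S : Set (Set (Fin 2 → ℝ))) : SimpleGraph S where
  Adj s t := s ≠ t ∧ (s.1 ∩ t.1).Nonempty
  symm := ⟨fun _ _ h => ⟨h.1.symm, by rw [Set.inter_comm]; exact h.2⟩⟩
  loopless := ⟨fun _ h => h.1 rfl⟩

/-- Site percolation on `S`: the law of the random set of open members of `S`, where each member
is open with probability `p`, independently. -/
noncomputable def percolation (S : Set (Set (Fin 2 → ℝ))) (p : unitInterval) :
    MeasureTheory.Measure (Set S) :=
  ProbabilityTheory.setBernoulli Set.univ p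

/-- `s` and `t` are connected in the subgraph induced on the set `ω` of open members
(in particular both are open). -/
def OpenConnected (S : Set (Set (Fin 2 → ℝ))) (ω : Set S) (s t : S) : Prop :=
  ∃ (hs : s ∈ ω) (ht : t ∈ ω), ((packingGraph S).induce ω).Reachable ⟨s, hs⟩ ⟨t, ht⟩

/-- The `ℓ^∞` distance between two sets, `inf {‖x - y‖_∞ : x ∈ s, y ∈ t}`
(a minimum if the sets are compact and non-empty). -/
noncomputable def setDist (s t : Set (Fin 2 → ℝ)) : ℝ :=
  sInf {d | ∃ x ∈ s, ∃ y ∈ t, d = dist x y}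

/-- The event that `s₀` is connected by open sets to some member at distance at least `r`. -/
def connectedToDist (S : Set (Set (Fin 2 → ℝ))) (s₀ : S) (r : ℝ) : Set (Set S) :=
  {ω | ∃ s : S, r ≤ setDist s₀ s ∧ OpenConnected S ω s₀ s}

/-- The event that `s₀` is connected to infinity: there is an open infinite path of the graph
which starts at `s₀` and whose distance from `s₀` in the plane tends to infinity. -/
def connectedToInfinity (S : Set (Set (Fin 2 → ℝ))) (s₀ : S) : Set (Set S) :=
  {ω | ∃ q : ℕ → S, q 0 = s₀ ∧ (∀ n, q n ∈ ω) ∧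
    (∀ n, (packingGraph S).Adj (q n) (q (n + 1))) ∧
    Filter.Tendsto (fun n => setDist s₀ (q n)) Filter.atTop Filter.atTop}

/-- `p > 0` is a constant for which the percolation theorem holds for square packings: in every
square packing no member is connected to infinity and, if the diameters are bounded with
supremum `D`, a member is connected to distance `r` with probability at most `e^{-r/D}`. -/
def IsPercolationConstant (p : unitInterval) : Prop :=
  0 < p ∧ ∀ S : Set (Set (Fin 2 → ℝ)), IsSquarePacking S → ∀ s₀ : S,
    percolation S p (connectedToInfinity S s₀) = 0 ∧
    (BddAbove (Metric.diam '' S) → ∀ r : ℝ, 0 < r →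
      (percolation S p).real (connectedToDist S s₀ r) ≤
        Real.exp (-(r / sSup (Metric.diam '' S))))

/-- The closed unit square `[0,1] × [0,1]`. -/
def unitSquare : Set (Fin 2 → ℝ) := Set.Icc 0 1

/-- The event of an open top-bottom crossing of the unit square: some member meeting the top side
is connected by open sets to some member meeting the bottom side. -/
def topBottomCrossing (S : Set (Set (Fin 2 → ℝ))) : Set (Set S) :=
  {ω | ∃ s t : S, (∃ x ∈ s.1, x ∈ unitSquare ∧ x 1 = 1) ∧
    (∃ y ∈ t.1, y ∈ unitSquare ∧ y 1 = 0) ∧ OpenConnected S ω s t}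

end SquarePercolation

/-! A constant `p` exists by a Peierls count of open chains. The obstacle is that a large square may
touch arbitrarily many small ones, so paths of given length cannot be counted directly. Instead a
step from radius `ρ u` to radius `ρ v` gets weight `(min (ρ u) (ρ v) / ρ u) ^ 2`. Comparing areas,
the weights of all steps from `u` add up to at most 25 (`tsum_stepWeight_le`), even when adjacency
is relaxed to `Near`.

The relaxation gives lower bounds on weights. In a shortest chain of near balls reaching distance
`r`, no two non-consecutive balls are near, so the balls strictly between them have total radius at
least a third of the smaller of the two. This limits how fast radii can drop: the product of all
descent ratios is at most `16 ^ (k + 1)` (`total_descent`), and the weight is at least `256 ^ -(k +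
1)` (`IsNearChain.exists_good`). Hence some such chain with `k + 1` balls is open with probability
at most `(256 * 25 * p) ^ (k + 1)`. Summing over `k` gives the exponential decay, and Borel–Cantelli
excludes connection to infinity.

For the crossing, fix `n`. By area at most `n ^ 2` squares have diameter above `1 / n`; they are all
closed with probability at least `(1/4) ^ n ^ 2`, independently of the rest. A crossing by the
remaining small squares would join some square of a row of side `1 / n`, placed on top of the unit
square, to distance `1 / 2`; by the decay and a union bound this crossing has probability at most `1
/ 2` for large `n`. Small values of `p` are handled by monotonicity, so one `n` serves all `p`. -/

namespace SquarePercolation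

/-! ### Descents of a positive sequence without deep narrow valleys -/

open Finset in
/-- If every valley of a positive sequence has total length comparable to its rim, then the total
descent inside a valley is exponential in the number of terms. -/
theorem valley_descent {a : ℕ → ℝ} (ha : ∀ l, 0 < a l) {N : ℕ}
    (hv : ∀ i j, i + 2 ≤ j → j ≤ N → min (a i) (a j) ≤ 3 * ∑ l ∈ Ico (i + 1) j, a l) :
    ∀ n i, i + 1 + n ≤ N → 1 ≤ n →
      (∀ l ∈ Ico (i + 1) (i + 1 + n), a l ≤ a i ∧ a l ≤ a (i + 1 + n)) →
      16 * (∏ l ∈ Ico (i + 1) (i + n), max 1 (a l / a (l + 1))) *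
        ∑ l ∈ Ico (i + 1) (i + 1 + n), a l ≤ 16 ^ n * a (i + 1) := by
  intro n
  induction n using Nat.strong_induction_on with
  | _ n ih =>
  intro i hN hn hval
  -- The highest term `h` of the valley splits it into two valleys, and `a h` is the lower rim of
  -- each. So `a h` is at most three times either partial sum, and the induction hypothesis applies
  -- to each nonempty side.
  obtain ⟨h, hh, hmax⟩ := exists_max_image (Ico (i + 1) (i + 1 + n)) a
    ⟨i + 1, by simp; omega⟩
  rw [mem_Ico] at hh
  obtain ⟨n₁, rfl⟩ : ∃ n₁, h = i + 1 + n₁ := ⟨h - (i + 1), by omega⟩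
  obtain ⟨n₂, rfl⟩ : ∃ n₂, n = n₁ + 1 + n₂ := ⟨n - n₁ - 1, by omega⟩
  set h := i + 1 + n₁ with hdef
  have hah := ha h
  have hmax' : ∀ l, i + 1 ≤ l → l < i + 1 + (n₁ + 1 + n₂) → a l ≤ a h := fun l h1 h2 =>
    hmax l (mem_Ico.2 ⟨h1, h2⟩)
  -- the sum splits at `h`
  have hsum : ∑ l ∈ Ico (i + 1) (i + 1 + (n₁ + 1 + n₂)), a l =
      ∑ l ∈ Ico (i + 1) h, a l + a h + ∑ l ∈ Ico (h + 1) (h + 1 + n₂), a l := by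
    rw [← sum_Ico_consecutive a (show i + 1 ≤ h by omega)
      (show h ≤ i + 1 + (n₁ + 1 + n₂) by omega),
      sum_eq_sum_Ico_succ_bot (show h < i + 1 + (n₁ + 1 + n₂) by omega)]
    rw [show i + 1 + (n₁ + 1 + n₂) = h + 1 + n₂ by omega]; ring
  have hrim := hval h (mem_Ico.2 hh)
  -- left valley
  have hleft : 1 ≤ n₁ → a h ≤ 3 * ∑ l ∈ Ico (i + 1) h, a l ∧
      16 * (∏ l ∈ Ico (i + 1) (i + n₁), max 1 (a l / a (l + 1))) *
        ∑ l ∈ Ico (i + 1) h, a l ≤ 16 ^ n₁ * a (i + 1) := by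
    intro h1
    refine ⟨?_, ?_⟩
    · have := hv i h (by omega) (by omega)
      rwa [min_eq_right hrim.1] at this
    · refine ih n₁ (by omega) i (by omega) h1 fun l hl => ?_
      rw [mem_Ico] at hl
      exact ⟨(hval l (mem_Ico.2 ⟨hl.1, by omega⟩)).1, hmax' l hl.1 (by omega)⟩
  have hright : 1 ≤ n₂ → a h ≤ 3 * ∑ l ∈ Ico (h + 1) (h + 1 + n₂), a l ∧
      16 * (∏ l ∈ Ico (h + 1) (h + n₂), max 1 (a l / a (l + 1))) *
        ∑ l ∈ Ico (h + 1) (h + 1 + n₂), a l ≤ 16 ^ n₂ * a (h + 1) := by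
    intro h1
    have hend : h + 1 + n₂ = i + 1 + (n₁ + 1 + n₂) := by omega
    refine ⟨?_, ?_⟩
    · have := hv h (h + 1 + n₂) (by omega) (by omega)
      rwa [min_eq_left (by rw [hend]; exact hrim.2)] at this
    · refine ih n₂ (by omega) h (by omega) h1 fun l hl => ?_
      rw [mem_Ico] at hl
      refine ⟨hmax' l (by omega) (by omega), ?_⟩
      rw [hend]
      exact (hval l (mem_Ico.2 ⟨by omega, by omega⟩)).2
  -- the factors around `h`
  have hup : ∀ l, i + 1 ≤ l → l + 1 = h → max 1 (a l / a (l + 1)) = 1 := by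
    intro l h1 h2
    refine max_eq_left ?_
    rw [div_le_one (ha _), h2]
    exact hmax' l h1 (by omega)
  have hdown : 1 ≤ n₂ → max 1 (a h / a (h + 1)) = a h / a (h + 1) := by
    intro h1
    refine max_eq_right ?_
    rw [le_div_iff₀ (ha _), one_mul]
    exact hmax' _ (by omega) (by omega)
  have hprod_right : 1 ≤ n₂ → ∏ l ∈ Ico h (i + (n₁ + 1 + n₂)), max 1 (a l / a (l + 1)) =
      a h / a (h + 1) * ∏ l ∈ Ico (h + 1) (h + n₂), max 1 (a l / a (l + 1)) := by
    intro h1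
    rw [prod_eq_prod_Ico_succ_bot (by omega), hdown h1,
      show i + (n₁ + 1 + n₂) = h + n₂ by omega]
  have hprod_left : 1 ≤ n₁ → ∏ l ∈ Ico (i + 1) h, max 1 (a l / a (l + 1)) =
      ∏ l ∈ Ico (i + 1) (i + n₁), max 1 (a l / a (l + 1)) := by
    intro h1
    rw [show h = (i + n₁) + 1 by omega, prod_Ico_succ_top (by omega),
      hup (i + n₁) (by omega) (by omega), mul_one]
  have hP₁ : 0 ≤ ∏ l ∈ Ico (i + 1) (i + n₁), max 1 (a l / a (l + 1)) :=
    prod_nonneg fun _ _ => by positivity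
  have hP₂ : 0 ≤ ∏ l ∈ Ico (h + 1) (h + n₂), max 1 (a l / a (l + 1)) :=
    prod_nonneg fun _ _ => by positivity
  have hS₁ : 0 ≤ ∑ l ∈ Ico (i + 1) h, a l := sum_nonneg fun _ _ => (ha _).le
  have hS₂ : 0 ≤ ∑ l ∈ Ico (h + 1) (h + 1 + n₂), a l := sum_nonneg fun _ _ => (ha _).le
  rw [hsum]
  have hai := ha (i + 1)
  have hah1 := ha (h + 1)
  rcases Nat.eq_zero_or_pos n₁ with h1 | h1 <;> rcases Nat.eq_zero_or_pos n₂ with h2 | h2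
  · subst h1 h2
    simp [hdef]
  · have hh' : h = i + 1 := by omega
    obtain ⟨hb, hQ⟩ := hright h2
    have := hprod_right h2
    rw [hh'] at this
    rw [this]
    subst h1
    rw [hh'] at hb hQ hS₂ hah1 hP₂ ⊢
    simp only [Ico_self, sum_empty, zero_add]
    set P := ∏ l ∈ Ico (i + 1 + 1) (i + 1 + n₂), max 1 (a l / a (l + 1))
    set T := ∑ l ∈ Ico (i + 1 + 1) (i + 1 + 1 + n₂), a l
    calc 16 * (a (i + 1) / a (i + 1 + 1) * P) * (a (i + 1) + T)
        ≤ 16 * (a (i + 1) / a (i + 1 + 1) * P) * (4 * T) := by gcongr; linarith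
      _ = 4 * (a (i + 1) / a (i + 1 + 1)) * (16 * P * T) := by ring
      _ ≤ 4 * (a (i + 1) / a (i + 1 + 1)) * (16 ^ n₂ * a (i + 1 + 1)) := by gcongr
      _ = 4 * (16 ^ n₂ * a (i + 1)) := by field_simp
      _ ≤ 16 * (16 ^ n₂ * a (i + 1)) := by gcongr; norm_num
      _ = 16 ^ (0 + 1 + n₂) * a (i + 1) := by ring
  · obtain ⟨hb, hQ⟩ := hleft h1
    subst h2
    rw [show i + (n₁ + 1 + 0) = h by omega, hprod_left h1]
    simp only [add_zero, Ico_self, sum_empty]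
    set P := ∏ l ∈ Ico (i + 1) (i + n₁), max 1 (a l / a (l + 1))
    set T := ∑ l ∈ Ico (i + 1) h, a l
    calc 16 * P * (T + a h) ≤ 16 * P * (4 * T) := by gcongr; linarith
      _ = 4 * (16 * P * T) := by ring
      _ ≤ 4 * (16 ^ n₁ * a (i + 1)) := by gcongr
      _ ≤ 16 * (16 ^ n₁ * a (i + 1)) := by gcongr; norm_num
      _ = 16 ^ (n₁ + 1) * a (i + 1) := by ring
  · obtain ⟨hb₁, hQ₁⟩ := hleft h1
    obtain ⟨hb₂, hQ₂⟩ := hright h2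
    rw [← prod_Ico_consecutive _ (show i + 1 ≤ h by omega)
      (show h ≤ i + (n₁ + 1 + n₂) by omega), hprod_left h1, hprod_right h2]
    set P₁ := ∏ l ∈ Ico (i + 1) (i + n₁), max 1 (a l / a (l + 1))
    set T₁ := ∑ l ∈ Ico (i + 1) h, a l
    set P₂ := ∏ l ∈ Ico (h + 1) (h + n₂), max 1 (a l / a (l + 1))
    set T₂ := ∑ l ∈ Ico (h + 1) (h + 1 + n₂), a l
    -- The three products contribute 3, 9 and 3 times `T₁ * T₂`, in total 15: this is why the base
    -- 16 suffices. The new descent factor `a h / a (h + 1)` is paid for by `a (h + 1)` on the right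
    -- of the second valley's bound.
    have hkey : a h * (T₁ + a h + T₂) ≤ 16 * (T₁ * T₂) := by
      have e1 : a h * T₁ ≤ 3 * T₂ * T₁ := by gcongr
      have e2 : a h * T₂ ≤ 3 * T₁ * T₂ := by gcongr
      have e3 : a h * a h ≤ (3 * T₁) * (3 * T₂) := by gcongr
      nlinarith [mul_nonneg hS₁ hS₂]
    calc 16 * (P₁ * (a h / a (h + 1) * P₂)) * (T₁ + a h + T₂)
        = 16 * P₁ * P₂ / a (h + 1) * (a h * (T₁ + a h + T₂)) := by ring
      _ ≤ 16 * P₁ * P₂ / a (h + 1) * (16 * (T₁ * T₂)) := by gcongr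
      _ = (16 * P₁ * T₁) * (16 * P₂ * T₂) / a (h + 1) := by ring
      _ ≤ (16 ^ n₁ * a (i + 1)) * (16 ^ n₂ * a (h + 1)) / a (h + 1) := by gcongr
      _ = 16 ^ n₁ * 16 ^ n₂ * a (i + 1) := by field_simp
      _ ≤ 16 * (16 ^ n₁ * 16 ^ n₂ * a (i + 1)) := by
          have : 0 ≤ (16 : ℝ) ^ n₁ * 16 ^ n₂ * a (i + 1) := by positivity
          linarith
      _ = 16 ^ (n₁ + 1 + n₂) * a (i + 1) := by ring

open Finset in
/-- The total descent up to a term that is maximal is exponential in the number of terms. -/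
theorem total_descent {a : ℕ → ℝ} (ha : ∀ l, 0 < a l) {N : ℕ}
    (hv : ∀ i j, i + 2 ≤ j → j ≤ N → min (a i) (a j) ≤ 3 * ∑ l ∈ Ico (i + 1) j, a l) :
    ∀ k ≤ N, (∀ l < k, a l ≤ a k) → ∏ l ∈ range k, max 1 (a l / a (l + 1)) ≤ 16 ^ k := by
  intro k
  induction k using Nat.strong_induction_on with
  | _ k ih =>
  intro hN hk
  rcases k with _ | k
  · simp
  -- The highest earlier term `h` is again maximal among its predecessors, so induction covers the
  -- descents up to `h`; what follows is a single valley between `h` and the last term.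
  obtain ⟨h, hh, hmax⟩ := exists_max_image (range (k + 1)) a ⟨0, by simp⟩
  simp only [mem_range] at hh hmax
  have h1 := ih h hh (by omega) fun l hl => hmax l (by omega)
  rw [range_eq_Ico, ← prod_Ico_consecutive _ (Nat.zero_le h) hh.le, ← range_eq_Ico,
    prod_Ico_succ_top (by omega), max_eq_left ((div_le_one (ha _)).2 (hk k (by omega))), mul_one]
  suffices h2 : ∏ l ∈ Ico h k, max 1 (a l / a (l + 1)) ≤ 16 ^ (k + 1 - h) by
    calc _ ≤ (16 : ℝ) ^ h * 16 ^ (k + 1 - h) := by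
          refine mul_le_mul h1 h2 (prod_nonneg fun _ _ => by positivity) (by positivity)
      _ = 16 ^ (k + 1) := by rw [← pow_add]; congr 1; omega
  rcases (Nat.lt_succ_iff.1 hh).eq_or_lt with rfl | hlt
  · simp
  obtain ⟨n, rfl⟩ : ∃ n, k = h + n := ⟨k - h, by omega⟩
  have hQ := valley_descent ha hv n h (by omega) (by omega) fun l hl => by
    rw [mem_Ico] at hl
    exact ⟨hmax l (by omega), by rw [show h + 1 + n = h + n + 1 by omega]; exact hk l (by omega)⟩
  have hb := hv h (h + n + 1) (by omega) hN
  rw [min_eq_left (hk h (by omega)), show h + n + 1 = h + 1 + n by omega] at hb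
  rw [prod_eq_prod_Ico_succ_bot (by omega), max_eq_right
    ((one_le_div (ha _)).2 (hmax (h + 1) (by omega)))]
  set P := ∏ l ∈ Ico (h + 1) (h + n), max 1 (a l / a (l + 1))
  set T := ∑ l ∈ Ico (h + 1) (h + 1 + n), a l
  have hP : 0 ≤ P := prod_nonneg fun _ _ => by positivity
  have := ha (h + 1)
  calc a h / a (h + 1) * P ≤ (3 * T) / a (h + 1) * P := by gcongr
    _ = 3 / 16 * (16 * P * T) / a (h + 1) := by ring
    _ ≤ 3 / 16 * (16 ^ n * a (h + 1)) / a (h + 1) := by gcongr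
    _ = 3 / 16 * 16 ^ n := by field_simp
    _ ≤ 16 * 16 ^ n := by gcongr; norm_num
    _ = 16 ^ (h + n + 1 - h) := by rw [show h + n + 1 - h = n + 1 by omega]; ring

end SquarePercolation

/-! ### Weighted chains of near balls -/

namespace SquarePercolation

open MeasureTheory
open scoped ENNReal

variable {ι : Type*}

/-- Two balls are near when their distance is at most the diameter of the smaller one. -/
def Near (x : ι → Fin 2 → ℝ) (ρ : ι → ℝ) (u v : ι) : Prop :=
  dist (x u) (x v) ≤ ρ u + ρ v + 2 * min (ρ u) (ρ v)

open Classical in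
/-- The weight of a step of a chain of near balls: the squared ratio of the radii for a step to a
smaller ball, and `1` for a step to a larger one. -/
noncomputable def stepWeight (x : ι → Fin 2 → ℝ) (ρ : ι → ℝ) (u v : ι) : ℝ≥0∞ :=
  if Near x ρ u v then ENNReal.ofReal ((max 1 (ρ u / ρ v))⁻¹ ^ 2) else 0

/-- The product of the weights of the steps of the chain `u, f 0, f 1, …`. -/
noncomputable def chainWeight (x : ι → Fin 2 → ℝ) (ρ : ι → ℝ) :
    ∀ k : ℕ, ι → (Fin k → ι) → ℝ≥0∞
  | 0, _, _ => 1
  | k + 1, u, f => stepWeight x ρ u (f 0) * chainWeight x ρ k (f 0) (Fin.tail f)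

theorem chainWeight_eq_prod (x : ι → Fin 2 → ℝ) (ρ : ι → ℝ) (k : ℕ) (t : ℕ → ι) :
    chainWeight x ρ k (t 0) (fun i => t (i + 1)) =
      ∏ l ∈ Finset.range k, stepWeight x ρ (t l) (t (l + 1)) := by
  induction k generalizing t with
  | zero => simp [chainWeight]
  | succ k ih =>
    rw [Finset.prod_range_succ', mul_comm, ← ih fun l => t (l + 1)]
    simp only [chainWeight]
    rfl

/-- A ball near `u` contains a ball with the smaller of the two radii which lies in the ball of
radius `5 * ρ u` around `u`. -/
theorem Near.exists_ball_subset {x : ι → Fin 2 → ℝ} {ρ : ι → ℝ} (hρ : ∀ u, 0 < ρ u) {u v : ι}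
    (h : Near x ρ u v) : ∃ y, Metric.ball y (min (ρ u) (ρ v)) ⊆
      Metric.ball (x v) (ρ v) ∩ Metric.ball (x u) (5 * ρ u) := by
  have hu := hρ u
  have hv := hρ v
  suffices H : ∃ y, dist y (x v) ≤ ρ v - min (ρ u) (ρ v) ∧
      dist y (x u) ≤ 5 * ρ u - min (ρ u) (ρ v) by
    obtain ⟨y, h1, h2⟩ := H
    exact ⟨y, Set.subset_inter (Metric.ball_subset_ball' (by linarith))
      (Metric.ball_subset_ball' (by linarith))⟩
  unfold Near at h
  rcases le_total (ρ v) (ρ u) with hle | hle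
  · rw [min_eq_right hle] at h ⊢
    exact ⟨x v, by simp, by rw [dist_comm]; linarith⟩
  · rw [min_eq_left hle] at h ⊢
    rcases le_or_gt (dist (x u) (x v)) (ρ v - ρ u) with hd | hd
    · exact ⟨x u, hd, by simp; linarith⟩
    -- Moving from `x v` towards `x u` by `ρ v - ρ u` is as far as a ball of radius `ρ u` can go
    -- inside ball `v`; nearness leaves a distance of at most `4 * ρ u` to `x u`.
    · have hpos : 0 < dist (x u) (x v) := by linarith
      refine ⟨AffineMap.lineMap (x v) (x u) ((ρ v - ρ u) / dist (x u) (x v)), ?_, ?_⟩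
      · rw [dist_lineMap_left, dist_comm (x v), Real.norm_of_nonneg
          (div_nonneg (by linarith) hpos.le), div_mul_cancel₀ _ hpos.ne']
      · rw [dist_lineMap_right, dist_comm (x v), Real.norm_of_nonneg
          (sub_nonneg.2 ((div_le_one hpos).2 hd.le)), sub_mul, div_mul_cancel₀ _ hpos.ne']
        linarith

/-- Each near `v` contains a ball of radius `min (ρ u) (ρ v)` inside the ball of radius `5 * ρ u`
around `x u`. These are disjoint, and their areas relative to that of ball `u` are exactly the
weights, so the total is at most `5 ^ 2`. -/
theorem tsum_stepWeight_le {x : ι → Fin 2 → ℝ} {ρ : ι → ℝ} (hρ : ∀ u, 0 < ρ u)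
    (hd : Pairwise fun u v => Disjoint (Metric.ball (x u) (ρ u)) (Metric.ball (x v) (ρ v)))
    (u : ι) : ∑' v, stepWeight x ρ u v ≤ 25 := by
  classical
  choose! y hy using fun v (h : Near x ρ u v) => h.exists_ball_subset hρ
  let A : ι → Set (Fin 2 → ℝ) := fun v =>
    if Near x ρ u v then Metric.ball (y v) (min (ρ u) (ρ v)) else ∅
  have hAm : ∀ v, MeasurableSet (A v) := fun v => by
    dsimp only [A]; split_ifs
    exacts [measurableSet_ball, MeasurableSet.empty]
  have hAv : ∀ v, A v ⊆ Metric.ball (x v) (ρ v) ∩ Metric.ball (x u) (5 * ρ u) := fun v => by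
    dsimp only [A]; split_ifs with h
    exacts [hy v h, Set.empty_subset _]
  have hu := hρ u
  have hvol : ∀ v, volume (A v) = ENNReal.ofReal ((2 * ρ u) ^ 2) * stepWeight x ρ u v := fun v => by
    have hv := hρ v
    dsimp only [A, stepWeight]; split_ifs with h
    · rw [Real.volume_pi_ball _ (lt_min hu hv), ← ENNReal.ofReal_mul (by positivity),
        Fintype.card_fin, ← mul_pow]
      congr 2
      rcases le_total (ρ v) (ρ u) with hle | hle
      · rw [min_eq_right hle, max_eq_right ((one_le_div hv).2 hle)]; field_simp
      · rw [min_eq_left hle, max_eq_left ((div_le_one hv).2 hle)]; simp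
    · simp
  have h1 : ∑' v, volume (A v) ≤ volume (Metric.ball (x u) (5 * ρ u)) :=
    (tsum_meas_le_meas_iUnion_of_disjoint volume hAm fun a b hab =>
      (hd hab).mono ((hAv a).trans Set.inter_subset_left)
        ((hAv b).trans Set.inter_subset_left)).trans
      (measure_mono (Set.iUnion_subset fun v => (hAv v).trans Set.inter_subset_right))
  simp only [hvol] at h1
  rw [ENNReal.tsum_mul_left, Real.volume_pi_ball _ (by positivity), Fintype.card_fin,
    show (2 * (5 * ρ u)) ^ 2 = (2 * ρ u) ^ 2 * 25 by ring, ENNReal.ofReal_mul (by positivity)] at h1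
  have h2 := (ENNReal.mul_le_mul_iff_right (ENNReal.ofReal_pos.2 (by positivity)).ne'
    ENNReal.ofReal_ne_top).1 h1
  simpa using h2

theorem tsum_chainWeight_le {x : ι → Fin 2 → ℝ} {ρ : ι → ℝ} (hρ : ∀ u, 0 < ρ u)
    (hd : Pairwise fun u v => Disjoint (Metric.ball (x u) (ρ u)) (Metric.ball (x v) (ρ v)))
    (k : ℕ) (u : ι) : ∑' f, chainWeight x ρ k u f ≤ 25 ^ k := by
  induction k generalizing u with
  | zero => simp [chainWeight]
  | succ k ih =>
    rw [← (Fin.consEquiv fun _ : Fin (k + 1) => ι).tsum_eq, ENNReal.tsum_prod']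
    calc ∑' v, ∑' f : Fin k → ι, chainWeight x ρ (k + 1) u (Fin.cons v f)
        = ∑' v, stepWeight x ρ u v * ∑' f, chainWeight x ρ k v f := by
          simp [chainWeight, ENNReal.tsum_mul_left]
      _ ≤ ∑' v, stepWeight x ρ u v * 25 ^ k := by gcongr; exact ih _
      _ = (∑' v, stepWeight x ρ u v) * 25 ^ k := ENNReal.tsum_mul_right
      _ ≤ 25 * 25 ^ k := by gcongr; exact tsum_stepWeight_le hρ hd u
      _ = 25 ^ (k + 1) := by ring

/-- `t 0, …, t k` is a chain of near balls in `O` that starts at `s` and reaches distance `r`. -/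
structure IsNearChain (x : ι → Fin 2 → ℝ) (ρ : ι → ℝ) (O : Set ι) (s : ι) (r : ℝ) (k : ℕ)
    (t : ℕ → ι) : Prop where
  start : t 0 = s
  mem : ∀ i ≤ k, t i ∈ O
  near : ∀ i < k, Near x ρ (t i) (t (i + 1))
  -- The factor 3 expresses that the gap `r - dist - ρ` to the outside of the ball of radius `r` is
  -- at most the diameter `2 * ρ`: the outside is treated as an infinitely large ball near `t k`.
  reach : r ≤ dist (x s) (x (t k)) + 3 * ρ (t k)

section Chain

variable {x : ι → Fin 2 → ℝ} {ρ : ι → ℝ} {O : Set ι} {s : ι} {r : ℝ} {k : ℕ} {t : ℕ → ι}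

/-- Cutting out the part of a chain between two near balls. -/
theorem IsNearChain.shortcut (h : IsNearChain x ρ O s r k t) {i j : ℕ} (hij : i < j) (hjk : j ≤ k)
    (hn : Near x ρ (t i) (t j)) :
    IsNearChain x ρ O s r (k - (j - i - 1)) fun l => if l ≤ i then t l else t (l + (j - i - 1)) where
  start := by simp [h.start]
  mem l hl := by
    split_ifs
    exacts [h.mem _ (by omega), h.mem _ (by omega)]
  near l hl := by
    rcases lt_trichotomy l i with h1 | rfl | h1
    · simpa [h1.le, Nat.succ_le_of_lt h1] using h.near l (by omega)
    · simpa [show l + 1 + (j - l - 1) = j by omega] using hn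
    · simp only [h1.not_ge, show ¬ l + 1 ≤ i by omega, if_false]
      rw [show l + 1 + (j - i - 1) = l + (j - i - 1) + 1 by omega]
      exact h.near _ (by omega)
  reach := by
    simp only [show ¬ k - (j - i - 1) ≤ i by omega, if_false]
    rw [show k - (j - i - 1) + (j - i - 1) = k by omega]
    exact h.reach

-- The gap of each step is charged to the diameter of its endpoint `l + 1`; the other sum comes from
-- crossing the intermediate balls.
open Finset in
theorem IsNearChain.dist_le (h : IsNearChain x ρ O s r k t) (i : ℕ) :
    ∀ j, i + 1 ≤ j → j ≤ k → dist (x (t i)) (x (t j)) ≤ ρ (t i) + ρ (t j) +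
      2 * ∑ l ∈ Ico (i + 1) j, ρ (t l) + 2 * ∑ l ∈ Ico (i + 1) (j + 1), ρ (t l) := by
  intro j hij
  induction j, hij using Nat.le_induction with
  | base =>
    intro hk
    have h1 : dist (x (t i)) (x (t (i + 1))) ≤ _ := h.near i (by omega)
    have h2 := min_le_right (ρ (t i)) (ρ (t (i + 1)))
    simp only [Ico_self, sum_empty, Nat.Ico_succ_singleton, sum_singleton]
    linarith
  | succ j hj ih =>
    intro hk
    have h1 : dist (x (t j)) (x (t (j + 1))) ≤ _ := h.near j (by omega)
    have h2 := min_le_right (ρ (t j)) (ρ (t (j + 1)))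
    have h3 := ih (by omega)
    have h4 := dist_triangle (x (t i)) (x (t j)) (x (t (j + 1)))
    rw [sum_Ico_succ_top (by omega : i + 1 ≤ j + 1) fun l => ρ (t l)]
    rw [sum_Ico_succ_top hj fun l => ρ (t l)] at h3 ⊢
    linarith

theorem IsNearChain.le_mul (h : IsNearChain x ρ O s r k t) {R : ℝ} (hR : ∀ u, ρ u ≤ R)
    (hR₀ : 0 ≤ R) : r ≤ 4 * (k + 1) * R := by
  have : ∀ j ≤ k, dist (x s) (x (t j)) ≤ 4 * j * R := by
    intro j hj
    induction j with
    | zero => simp [h.start]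
    | succ j ih =>
      have h1 : dist (x (t j)) (x (t (j + 1))) ≤ _ := h.near j (by omega)
      have h2 := min_le_right (ρ (t j)) (ρ (t (j + 1)))
      have h3 := ih (by omega)
      have h4 := dist_triangle (x s) (x (t j)) (x (t (j + 1)))
      have h5 := hR (t j)
      have h6 := hR (t (j + 1))
      push_cast
      linarith
  have h1 := this k le_rfl
  have h2 := h.reach
  have h3 := hR (t k)
  linarith

open Finset in
/-- A chain that reaches distance `r` can be replaced by one whose number of possibilities is
exponential in its length. -/
theorem IsNearChain.exists_good (hρ : ∀ u, 0 < ρ u) (h : IsNearChain x ρ O s r k t) :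
    ∃ k t, IsNearChain x ρ O s r k t ∧ Set.InjOn t (Set.Iic k) ∧
      (256 ^ (k + 1))⁻¹ ≤ chainWeight x ρ k s fun i => t (i + 1) := by
  classical
  have hex : ∃ k, ∃ t, IsNearChain x ρ O s r k t := ⟨k, t, h⟩
  clear h
  -- A chain of minimal length admits no shortcut and does not reach distance `r` early.
  obtain ⟨t, h⟩ := Nat.find_spec hex
  have hmin : ∀ m < Nat.find hex, ∀ t, ¬ IsNearChain x ρ O s r m t := fun m hm t ht =>
    Nat.find_min hex hm ⟨t, ht⟩
  generalize Nat.find hex = k at h hmin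
  have hfar : ∀ i j, i + 2 ≤ j → j ≤ k → ¬ Near x ρ (t i) (t j) := fun i j hij hj hn =>
    hmin _ (by omega) _ (h.shortcut (by omega) hj hn)
  have hlt : ∀ i < k, dist (x s) (x (t i)) + 3 * ρ (t i) < r := fun i hi => by
    by_contra! hr
    exact hmin i hi t ⟨h.start, fun j hj => h.mem j (by omega), fun j hj => h.near j (by omega), hr⟩
  refine ⟨k, t, h, ?_, ?_⟩
  · suffices H : ∀ i j, i < j → j ≤ k → t i ≠ t j by
      intro i hi j hj hij
      by_contra hne
      rcases lt_or_gt_of_ne hne with hl | hl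
      exacts [H i j hl hj hij, H j i hl hi hij.symm]
    intro i j hij hj he
    rcases eq_or_lt_of_le hj with rfl | hjk
    · have := hlt i hij
      rw [he] at this
      exact this.not_ge h.reach
    · refine hfar i (j + 1) (by omega) (by omega) ?_
      rw [he]
      exact h.near j hjk
  -- The sequence of radii is extended by a last term `M` that dominates all others; it plays the
  -- role of the outside of the ball of radius `r` and makes `total_descent` applicable at index `k
  -- + 1`.
  · let M := ∑ l ∈ range (k + 1), ρ (t l)
    let a : ℕ → ℝ := fun l => if l ≤ k then ρ (t l) else M
    have hM : 0 < M := sum_pos (fun _ _ => hρ _) ⟨0, by simp⟩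
    have ha : ∀ l, 0 < a l := fun l => by
      dsimp only [a]; split_ifs
      exacts [hρ _, hM]
    have hak : ∀ l ≤ k, a l = ρ (t l) := fun l hl => if_pos hl
    have hsum : ∀ i j, j ≤ k + 1 → ∑ l ∈ Ico i j, a l = ∑ l ∈ Ico i j, ρ (t l) := fun i j hj =>
      sum_congr rfl fun l hl => hak l (by rw [mem_Ico] at hl; omega)
    -- The gap between balls `i` and `j` is at most `6` times the sum of the radii in between, while
    -- non-nearness makes it exceed twice the smaller radius. At `j = k + 1` the failure of ball `i`
    -- to reach `r` replaces non-nearness.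
    have hv : ∀ i j, i + 2 ≤ j → j ≤ k + 1 → min (a i) (a j) ≤ 3 * ∑ l ∈ Ico (i + 1) j, a l := by
      intro i j hij hj
      rw [hsum _ _ hj]
      rcases eq_or_lt_of_le hj with rfl | hjk
      · refine (min_le_left _ _).trans ?_
        rw [hak i (by omega)]
        have h1 := h.dist_le i k (by omega) le_rfl
        have h2 := hlt i (by omega)
        have h3 := h.reach
        have h4 := dist_triangle (x s) (x (t i)) (x (t k))
        have h5 : 0 ≤ ∑ l ∈ Ico (i + 1) k, ρ (t l) := sum_nonneg fun _ _ => (hρ _).le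
        rw [sum_Ico_succ_top (by omega) fun l => ρ (t l)] at h1 ⊢
        linarith
      · obtain ⟨m, rfl⟩ : ∃ m, j = m + 1 := ⟨j - 1, by omega⟩
        have h1 := h.dist_le i m (by omega) (by omega)
        have h2 := hfar i (m + 1) (by omega) (by omega)
        have h3 : dist (x (t m)) (x (t (m + 1))) ≤ _ := h.near m (by omega)
        have h4 := dist_triangle (x (t i)) (x (t m)) (x (t (m + 1)))
        have h5 : 0 ≤ ∑ l ∈ Ico (i + 1) m, ρ (t l) := sum_nonneg fun _ _ => (hρ _).le
        have h6 := min_le_left (ρ (t m)) (ρ (t (m + 1)))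
        unfold Near at h2
        rw [hak i (by omega), hak (m + 1) (by omega)]
        rw [sum_Ico_succ_top (by omega) fun l => ρ (t l)] at h1 ⊢
        linarith
    have htot := total_descent ha hv (k + 1) le_rfl fun l hl => by
      rw [hak l (by omega)]
      simp only [a, show ¬ k + 1 ≤ k by omega, if_false]
      exact single_le_sum (f := fun l => ρ (t l)) (fun _ _ => (hρ _).le) (by simpa using hl)
    have hprod : ∏ l ∈ range k, max 1 (ρ (t l) / ρ (t (l + 1))) ≤ 16 ^ (k + 1) := by
      rw [prod_range_succ] at htot
      calc _ = ∏ l ∈ range k, max 1 (a l / a (l + 1)) := prod_congr rfl fun l hl => by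
            rw [mem_range] at hl
            rw [hak l hl.le, hak (l + 1) hl]
        _ ≤ (∏ l ∈ range k, max 1 (a l / a (l + 1))) * max 1 (a k / a (k + 1)) :=
          le_mul_of_one_le_right (prod_nonneg fun _ _ => by positivity) (le_max_left _ _)
        _ ≤ _ := htot
    have hpos : 0 < ∏ l ∈ range k, max 1 (ρ (t l) / ρ (t (l + 1))) :=
      prod_pos fun _ _ => by positivity
    rw [← h.start, chainWeight_eq_prod]
    calc ((256 : ℝ≥0∞) ^ (k + 1))⁻¹ = ENNReal.ofReal ((16 ^ (k + 1))⁻¹ ^ 2) := by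
          rw [inv_pow, ENNReal.ofReal_inv_of_pos (by positivity), ← pow_mul, mul_comm, pow_mul,
            ENNReal.ofReal_pow (by norm_num)]
          norm_num
      _ ≤ ENNReal.ofReal ((∏ l ∈ range k, max 1 (ρ (t l) / ρ (t (l + 1))))⁻¹ ^ 2) := by gcongr
      _ = ∏ l ∈ range k, stepWeight x ρ (t l) (t (l + 1)) := by
          rw [← prod_inv_distrib, ← prod_pow, ENNReal.ofReal_prod_of_nonneg fun _ _ => by positivity]
          refine prod_congr rfl fun l hl => ?_
          rw [stepWeight, if_pos (h.near l (mem_range.1 hl))]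

end Chain

end SquarePercolation

/-! ### Peierls estimate and existence of percolation constants -/

namespace SquarePercolation

open MeasureTheory ProbabilityTheory
open scoped ENNReal

instance (S : Set (Set (Fin 2 → ℝ))) (p : unitInterval) : IsProbabilityMeasure (percolation S p) :=
  inferInstanceAs (IsProbabilityMeasure (setBernoulli Set.univ p))

theorem percolation_forall_mem (S : Set (Set (Fin 2 → ℝ))) (p : unitInterval) (F : Finset S) :
    percolation S p {ω | ∀ s ∈ F, s ∈ ω} = ENNReal.ofReal p ^ F.card := by
  have h : (fun q : S → Prop => {i | q i}) ⁻¹' {ω | ∀ s ∈ F, s ∈ ω} =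
      Set.pi F fun _ => {True} := by
    ext q
    simp [Set.pi]
  rw [percolation, setBernoulli_apply', h, Measure.infinitePi_pi _ fun _ _ => .of_discrete]
  have h2 : ENNReal.ofReal p = (unitInterval.toNNReal p : ℝ≥0∞) := by
    rw [ENNReal.ofReal]; congr 1; ext; simp [p.2.1]
  simp [h2]

theorem IsSquare.exists_eq_closedBall {s : Set (Fin 2 → ℝ)} (h : IsSquare s) :
    ∃ (x : Fin 2 → ℝ) (ρ : ℝ), 0 < ρ ∧ s = Metric.closedBall x ρ := by
  obtain ⟨a, l, hl, rfl⟩ := h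
  refine ⟨fun i => a i + l / 2, l / 2, by positivity, ?_⟩
  ext y
  rw [Metric.mem_closedBall, dist_pi_le_iff (by positivity), Set.mem_Icc, Pi.le_def, Pi.le_def,
    ← forall_and]
  refine forall_congr' fun i => ?_
  rw [Real.dist_eq, abs_le]
  constructor <;> rintro ⟨h1, h2⟩ <;> constructor <;> linarith

/-- Connectedness by open squares, as the existence of a sequence of open squares. -/
theorem openConnected_iff {S : Set (Set (Fin 2 → ℝ))} {ω : Set S} {s t : S} :
    OpenConnected S ω s t ↔ ∃ (k : ℕ) (q : ℕ → S), q 0 = s ∧ q k = t ∧ (∀ i ≤ k, q i ∈ ω) ∧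
      ∀ i < k, ((q i).1 ∩ (q (i + 1)).1).Nonempty := by
  constructor
  · rintro ⟨hs, ht, ⟨w⟩⟩
    exact ⟨w.length, fun i => (w.getVert i).1, by simp, by simp, fun i _ => (w.getVert i).2,
      fun i hi => (w.adj_getVert_succ hi).2⟩
  · rintro ⟨k, q, rfl, rfl, hω, hq⟩
    have : ∀ j (hj : j ≤ k), ((packingGraph S).induce ω).Reachable ⟨q 0, hω 0 (Nat.zero_le k)⟩
        ⟨q j, hω j hj⟩ := by
      intro j
      induction j with
      | zero => intro _; rfl
      | succ j ih =>
        intro hj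
        refine (ih (by omega)).trans ?_
        by_cases he : q j = q (j + 1)
        · simp only [he]; rfl
        · exact SimpleGraph.Adj.reachable ⟨he, hq j (by omega)⟩
    exact ⟨_, _, this k le_rfl⟩

theorem setDist_le_dist {s t : Set (Fin 2 → ℝ)} {x y : Fin 2 → ℝ} (hx : x ∈ s) (hy : y ∈ t) :
    setDist s t ≤ dist x y :=
  csInf_le ⟨0, by rintro _ ⟨x, _, y, _, rfl⟩; exact dist_nonneg⟩ ⟨x, hx, y, hy, rfl⟩

/-- The chains of `k + 1` distinct balls from `s` that are relevant for the union bound. -/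
def goodChains {ι : Type*} (x : ι → Fin 2 → ℝ) (ρ : ι → ℝ) (s : ι) (k : ℕ) : Set (Fin k → ι) :=
  {f | Function.Injective (Fin.cons s f : Fin (k + 1) → ι) ∧
    (256 ^ (k + 1))⁻¹ ≤ chainWeight x ρ k s f}

section Packing

variable {S : Set (Set (Fin 2 → ℝ))} {x : S → Fin 2 → ℝ} {ρ : S → ℝ}

theorem IsSquarePacking.pairwise_disjoint_ball (hS : IsSquarePacking S) (hρ : ∀ u, 0 < ρ u)
    (hx : ∀ u : S, u.1 = Metric.closedBall (x u) (ρ u)) :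
    Pairwise fun u v => Disjoint (Metric.ball (x u) (ρ u)) (Metric.ball (x v) (ρ v)) := by
  intro u v huv
  have := hS.disjoint_interior u.2 v.2 fun h => huv (Subtype.ext h)
  rwa [hx u, hx v, interior_closedBall _ (hρ u).ne', interior_closedBall _ (hρ v).ne'] at this

theorem near_of_inter_nonempty (hρ : ∀ u, 0 < ρ u)
    (hx : ∀ u : S, u.1 = Metric.closedBall (x u) (ρ u)) {u v : S} (h : (u.1 ∩ v.1).Nonempty) :
    Near x ρ u v := by
  obtain ⟨y, hu, hv⟩ := h
  rw [hx, Metric.mem_closedBall] at hu hv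
  have h1 := dist_triangle_left (x u) (x v) y
  have h2 := lt_min (hρ u) (hρ v)
  unfold Near
  linarith

theorem exists_nearChain (hρ : ∀ u, 0 < ρ u)
    (hx : ∀ u : S, u.1 = Metric.closedBall (x u) (ρ u)) {s₀ : S} {r : ℝ} {ω : Set S}
    (h : ω ∈ connectedToDist S s₀ r) : ∃ k t, IsNearChain x ρ ω s₀ r k t := by
  obtain ⟨s, hr, hc⟩ := h
  obtain ⟨k, q, hq0, hqk, hω, hq⟩ := openConnected_iff.1 hc
  have hmem : ∀ u : S, x u ∈ u.1 := fun u => by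
    rw [hx u]; exact Metric.mem_closedBall_self (hρ u).le
  refine ⟨k, q, hq0, hω, fun i hi => near_of_inter_nonempty hρ hx (hq i hi), ?_⟩
  rw [hqk]
  have := setDist_le_dist (hmem s₀) (hmem s)
  have := hρ s
  linarith

/-- Only finitely many terms of a summable family of weights exceed a positive threshold. -/
theorem finite_goodChains (hS : IsSquarePacking S) (hρ : ∀ u, 0 < ρ u)
    (hx : ∀ u : S, u.1 = Metric.closedBall (x u) (ρ u)) (s₀ : S) (k : ℕ) :
    (goodChains x ρ s₀ k).Finite := by
  have h1 := tsum_chainWeight_le hρ (hS.pairwise_disjoint_ball hρ hx) k s₀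
  have h2 := ENNReal.finite_const_le_of_tsum_ne_top (ne_top_of_le_ne_top (by simp) h1)
    (ε := (256 ^ (k + 1))⁻¹) (by simp)
  exact h2.subset fun f hf => hf.2

/-- The `k + 1` squares of a good chain are distinct, so all are open with probability `p ^ (k +
1)`, at most `(256 * p) ^ (k + 1)` times the weight. Summing the weights costs `25 ^ k`, and `256 *
25 = 6400`. -/
theorem percolation_exists_goodChain_le (hS : IsSquarePacking S) (hρ : ∀ u, 0 < ρ u)
    (hx : ∀ u : S, u.1 = Metric.closedBall (x u) (ρ u)) (s₀ : S) (k : ℕ) (p : unitInterval) :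
    percolation S p {ω : Set S | ∃ f ∈ goodChains x ρ s₀ k, s₀ ∈ ω ∧ ∀ i, f i ∈ ω} ≤
      ENNReal.ofReal (6400 * p) ^ (k + 1) := by
  classical
  have : Countable S := hS.countable.to_subtype
  have hsub : {ω : Set S | ∃ f ∈ goodChains x ρ s₀ k, s₀ ∈ ω ∧ ∀ i, f i ∈ ω} ⊆
      ⋃ f : Fin k → S, {ω : Set S | f ∈ goodChains x ρ s₀ k ∧ s₀ ∈ ω ∧ ∀ i, f i ∈ ω} := by
    rintro ω ⟨f, hf, h⟩
    exact Set.mem_iUnion.2 ⟨f, hf, h⟩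
  have hterm : ∀ f : Fin k → S,
      percolation S p {ω : Set S | f ∈ goodChains x ρ s₀ k ∧ s₀ ∈ ω ∧ ∀ i, f i ∈ ω} ≤
        (ENNReal.ofReal p * 256) ^ (k + 1) * chainWeight x ρ k s₀ f := by
    intro f
    by_cases hf : f ∈ goodChains x ρ s₀ k
    · calc _ ≤ percolation S p {ω : Set S | ∀ s ∈ (Finset.univ.image (Fin.cons s₀ f : Fin (k + 1) → S) :
            Finset S), s ∈ ω} := by
            refine measure_mono fun ω h s hs => ?_
            obtain ⟨i, -, rfl⟩ := Finset.mem_image.1 hs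
            exact Fin.cases h.2.1 h.2.2 i
        _ = ENNReal.ofReal p ^ (k + 1) * (256 ^ (k + 1) * (256 ^ (k + 1))⁻¹) := by
            rw [percolation_forall_mem, Finset.card_image_of_injective _ hf.1,
              ENNReal.mul_inv_cancel (by simp) (by simp)]
            simp
        _ ≤ ENNReal.ofReal p ^ (k + 1) * (256 ^ (k + 1) * chainWeight x ρ k s₀ f) := by
            gcongr; exact hf.2
        _ = _ := by rw [mul_pow, mul_assoc]
    · simp [hf]
  calc _ ≤ ∑' f : Fin k → S,
        percolation S p {ω : Set S | f ∈ goodChains x ρ s₀ k ∧ s₀ ∈ ω ∧ ∀ i, f i ∈ ω} :=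
        (measure_mono hsub).trans (measure_iUnion_le _)
    _ ≤ ∑' f : Fin k → S, (ENNReal.ofReal p * 256) ^ (k + 1) * chainWeight x ρ k s₀ f :=
        ENNReal.tsum_le_tsum hterm
    _ = (ENNReal.ofReal p * 256) ^ (k + 1) * ∑' f, chainWeight x ρ k s₀ f := ENNReal.tsum_mul_left
    _ ≤ (ENNReal.ofReal p * 256) ^ (k + 1) * 25 ^ (k + 1) := by
        gcongr
        exact (tsum_chainWeight_le hρ (hS.pairwise_disjoint_ball hρ hx) k s₀).trans
          (pow_le_pow_right₀ (by norm_num) (by omega))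
    _ = ENNReal.ofReal (6400 * p) ^ (k + 1) := by
        rw [← mul_pow, ENNReal.ofReal_mul (by norm_num), mul_assoc, mul_comm]
        congr 2
        norm_num

theorem exists_goodChain (hρ : ∀ u, 0 < ρ u)
    (hx : ∀ u : S, u.1 = Metric.closedBall (x u) (ρ u)) {s₀ : S} {r : ℝ} {ω : Set S}
    (h : ω ∈ connectedToDist S s₀ r) :
    ∃ k t, IsNearChain x ρ ω s₀ r k t ∧ (fun i : Fin k => t (i + 1)) ∈ goodChains x ρ s₀ k ∧
      s₀ ∈ ω ∧ ∀ i : Fin k, t (i + 1) ∈ ω := by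
  obtain ⟨k, t, h⟩ := exists_nearChain hρ hx h
  obtain ⟨k, t, h, hinj, hw⟩ := h.exists_good hρ
  refine ⟨k, t, h, ⟨?_, hw⟩, h.start ▸ h.mem 0 (Nat.zero_le k), fun i => h.mem _ (by omega)⟩
  have : (Fin.cons s₀ (fun i : Fin k => t (i + 1)) : Fin (k + 1) → S) = fun i => t i.1 := by
    funext i
    refine Fin.cases ?_ (fun i => ?_) i
    · simp [h.start]
    · simp
  rw [this]
  intro i j hij
  exact Fin.ext (hinj (by simp; omega) (by simp; omega) hij)

theorem connectedToInfinity_subset_connectedToDist (s₀ : S) (r : ℝ) :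
    connectedToInfinity S s₀ ⊆ connectedToDist S s₀ r := by
  rintro ω ⟨q, hq0, hω, hq, hlim⟩
  obtain ⟨n, hn⟩ := (hlim.eventually_ge_atTop r).exists
  exact ⟨q n, hn, openConnected_iff.2 ⟨n, q, hq0, rfl, fun i _ => hω i, fun i _ => (hq i).2⟩⟩

/-- By Borel–Cantelli, almost surely good chains are open for only finitely many lengths. Connection
to infinity would require arbitrarily long ones, since the finitely many good chains of bounded
length have bounded reach. -/
theorem percolation_connectedToInfinity_eq_zero (hS : IsSquarePacking S) (s₀ : S)
    {p : unitInterval} (hp : 6400 * (p : ℝ) < 1) :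
    percolation S p (connectedToInfinity S s₀) = 0 := by
  choose x ρ hρ hx using fun u : S => (hS.isSquare u u.2).exists_eq_closedBall
  have hfreq : percolation S p {ω | ∃ᶠ k in Filter.atTop,
      ∃ f ∈ goodChains x ρ s₀ k, s₀ ∈ ω ∧ ∀ i, f i ∈ ω} = 0 := by
    refine measure_setOfPred_frequently_eq_zero (ne_top_of_le_ne_top ?_
      (ENNReal.tsum_le_tsum fun k => percolation_exists_goodChain_le hS hρ hx s₀ k p))
    have h1 : ENNReal.ofReal (6400 * p) < 1 := by rwa [ENNReal.ofReal_lt_one]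
    rw [ENNReal.tsum_geometric_add_one]
    exact ENNReal.mul_ne_top ENNReal.ofReal_ne_top
      (ENNReal.inv_ne_top.2 (tsub_pos_of_lt h1).ne')
  refine measure_mono_null (fun ω hω => ?_) hfreq
  rw [Set.mem_ofPred_eq, Filter.frequently_atTop]
  intro k₀
  have hbdd : ∀ k, ∃ B : ℝ, ∀ f ∈ goodChains x ρ s₀ k, ∀ u ∈ Set.range (Fin.cons s₀ f : Fin (k + 1) → S),
      dist (x s₀) (x u) + 3 * ρ u ≤ B := by
    intro k
    have hfin : (⋃ f ∈ goodChains x ρ s₀ k, Set.range (Fin.cons s₀ f : Fin (k + 1) → S)).Finite :=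
      (finite_goodChains hS hρ hx s₀ k).biUnion fun f _ => Set.finite_range _
    obtain ⟨B, hB⟩ := (hfin.image fun u => dist (x s₀) (x u) + 3 * ρ u).bddAbove
    exact ⟨B, fun f hf u hu => hB ⟨u, Set.mem_biUnion hf hu, rfl⟩⟩
  choose B hB using hbdd
  obtain ⟨C, hC⟩ := ((Set.finite_Iio k₀).image B).bddAbove
  obtain ⟨k, t, h, hgood, ho⟩ :=
    exists_goodChain hρ hx (connectedToInfinity_subset_connectedToDist s₀ (C + 1) hω)
  refine ⟨k, ?_, _, hgood, ho⟩
  by_contra! hk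
  have h1 := hC ⟨k, hk, rfl⟩
  have h2 := hB k _ hgood (t k) ⟨Fin.last k, by
    rcases k with _ | k
    · simp [h.start]
    · rw [← Fin.succ_last, Fin.cons_succ]; simp⟩
  have h3 := h.reach
  linarith

theorem percolation_connectedToDist_le (hS : IsSquarePacking S) (s₀ : S) {p : unitInterval}
    (hp : (p : ℝ) ≤ 1 / 200000) {D : ℝ} (hD : ∀ s ∈ S, Metric.diam s ≤ D) (r : ℝ) :
    (percolation S p).real (connectedToDist S s₀ r) ≤ Real.exp (-(r / D)) := by
  choose x ρ hρ hx using fun u : S => (hS.isSquare u u.2).exists_eq_closedBall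
  have hR : ∀ u, ρ u ≤ D / 2 := fun u => by
    have := hD u u.2
    rw [hx u, Metric.diam_closedBall_eq _ (hρ u).le] at this
    linarith
  have hp₀ : 0 ≤ (p : ℝ) := p.2.1
  have hDpos : 0 < D := by linarith [hρ s₀, hR s₀]
  have hsub : connectedToDist S s₀ r ⊆ ⋃ k : ℕ, {ω | r ≤ 4 * ((k : ℝ) + 1) * (D / 2) ∧
      ω ∈ {ω | ∃ f ∈ goodChains x ρ s₀ k, s₀ ∈ ω ∧ ∀ i, f i ∈ ω}} := by
    intro ω hω
    obtain ⟨k, t, h, hgood, ho⟩ := exists_goodChain hρ hx hω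
    exact Set.mem_iUnion.2 ⟨k, h.le_mul hR (by positivity), _, hgood, ho⟩
  have hterm : ∀ k : ℕ, percolation S p {ω | r ≤ 4 * ((k : ℝ) + 1) * (D / 2) ∧
      ω ∈ {ω | ∃ f ∈ goodChains x ρ s₀ k, s₀ ∈ ω ∧ ∀ i, f i ∈ ω}} ≤
      2⁻¹ ^ (k + 1) * ENNReal.ofReal (Real.exp (-(r / D))) := by
    intro k
    by_cases hk : r ≤ 4 * ((k : ℝ) + 1) * (D / 2)
    · simp only [hk, true_and]
      refine (percolation_exists_goodChain_le hS hρ hx s₀ k p).trans ?_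
      have h2 : (2⁻¹ : ℝ≥0∞) = ENNReal.ofReal (1 / 2) := by
        rw [one_div, ENNReal.ofReal_inv_of_pos (by norm_num)]; norm_num
      rw [h2, ← ENNReal.ofReal_pow (mul_nonneg (by norm_num) hp₀),
        ← ENNReal.ofReal_pow (by norm_num),
        ← ENNReal.ofReal_mul (by positivity)]
      refine ENNReal.ofReal_le_ofReal ?_
      have hrD : r / D ≤ (k + 1 : ℕ) * 2 := by
        rw [div_le_iff₀ hDpos]; push_cast; linarith
      -- The bound on `p` is chosen so that `6400 * p` splits into `exp (-2)`, whose power `k + 1`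
      -- is at most `exp (-(r / D))` as `r / D ≤ 2 * (k + 1)`, and `1 / 2`, whose powers sum to 1
      -- over `k`.
      have he : 6400 * (p : ℝ) ≤ 1 / 2 * Real.exp (-2) := by
        have h3 : Real.exp 2 ≤ 8 := by
          have h4 := Real.exp_one_lt_d9
          have h5 : Real.exp 2 = Real.exp 1 * Real.exp 1 := by rw [← Real.exp_add]; norm_num
          have h6 := Real.exp_pos 1
          nlinarith
        rw [Real.exp_neg]
        have h7 : (8 : ℝ)⁻¹ ≤ (Real.exp 2)⁻¹ := inv_anti₀ (Real.exp_pos 2) h3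
        linarith
      calc (6400 * (p : ℝ)) ^ (k + 1) ≤ (1 / 2 * Real.exp (-2)) ^ (k + 1) :=
            pow_le_pow_left₀ (by positivity) he _
        _ = (1 / 2) ^ (k + 1) * Real.exp (-((k + 1 : ℕ) * 2)) := by
            rw [mul_pow, ← Real.exp_nat_mul]; congr 2; ring
        _ ≤ (1 / 2) ^ (k + 1) * Real.exp (-(r / D)) := by gcongr
    · simp [hk]
  refine ENNReal.toReal_le_of_le_ofReal (Real.exp_pos _).le ?_
  calc _ ≤ ∑' k : ℕ, 2⁻¹ ^ (k + 1) * ENNReal.ofReal (Real.exp (-(r / D))) :=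
        (measure_mono hsub).trans ((measure_iUnion_le _).trans (ENNReal.tsum_le_tsum hterm))
    _ = ENNReal.ofReal (Real.exp (-(r / D))) := by
        rw [ENNReal.tsum_mul_right, ENNReal.tsum_geometric_add_one, ENNReal.one_sub_inv_two,
          inv_inv, ENNReal.inv_mul_cancel (by simp) (by simp), one_mul]

end Packing

theorem isPercolationConstant_of_le {p : unitInterval} (hp₀ : 0 < p) (hp : (p : ℝ) ≤ 1 / 200000) :
    IsPercolationConstant p :=
  ⟨hp₀, fun _ hS s₀ => ⟨percolation_connectedToInfinity_eq_zero hS s₀ (by linarith), fun hb r _ =>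
    percolation_connectedToDist_le hS s₀ hp (fun s hs => le_csSup hb ⟨s, hs, rfl⟩) r⟩⟩

end SquarePercolation

/-! ### Coupling by uniform labels -/

namespace SquarePercolation

open MeasureTheory ProbabilityTheory
open scoped ENNReal

/-- Independent uniform labels in `[0,1]` on all subsets of the plane. -/
noncomputable abbrev uniformLabels : Measure (Set (Fin 2 → ℝ) → unitInterval) :=
  Measure.infinitePi fun _ => volume

/-- The members of `A` whose label is at most `p`. -/
def openIn (A : Set (Set (Fin 2 → ℝ))) (p : unitInterval) (U : Set (Fin 2 → ℝ) → unitInterval) :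
    Set A :=
  {s | U s ≤ p}

theorem measurable_openIn (A : Set (Set (Fin 2 → ℝ))) (p : unitInterval) :
    Measurable (openIn A p) :=
  measurable_set_iff.2 fun s => (measurableSet_Iic (a := p)).mem.comp (measurable_pi_apply s.1)

theorem map_le_volume (p : unitInterval) :
    (volume : Measure unitInterval).map (fun u => u ≤ p) =
      unitInterval.toNNReal p • Measure.dirac True +
        unitInterval.toNNReal (unitInterval.symm p) • Measure.dirac False := by
  have hm : Measurable fun u : unitInterval => u ≤ p := (measurableSet_Iic (a := p)).mem
  have h1 : (volume {u : unitInterval | u ≤ p}) = (unitInterval.toNNReal p : ℝ≥0∞) := by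
    have := unitInterval.volume_Iic p
    rw [Set.Iic] at this
    rw [this, ENNReal.ofReal]; congr 1; ext; simp [p.2.1]
  have h2 : (volume {u : unitInterval | ¬ u ≤ p}) =
      (unitInterval.toNNReal (unitInterval.symm p) : ℝ≥0∞) := by
    have := unitInterval.volume_Ioi p
    rw [Set.Ioi] at this
    simp only [not_le]
    rw [this, ENNReal.ofReal]; congr 1; ext; simp [p.2.2]
  refine Measure.ext_of_singleton fun q => ?_
  rw [Measure.map_apply hm (measurableSet_singleton q)]
  by_cases hq : q
  · have : (fun u : unitInterval => u ≤ p) ⁻¹' {q} = {u | u ≤ p} := by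
      ext u; simp [hq]
    rw [this, h1]
    simp [hq]
  · have : (fun u : unitInterval => u ≤ p) ⁻¹' {q} = {u | ¬ u ≤ p} := by
      ext u; simp [hq]
    rw [this, h2]
    simp [hq]

/-- One family of labels realises percolation on every collection and for every `p`, so
subcollections, enlarged packings and different values of `p` can be compared on a single
probability space. -/
theorem percolation_eq_map (S : Set (Set (Fin 2 → ℝ))) (p : unitInterval) :
    percolation S p = uniformLabels.map (openIn S p) := by
  have hm : Measurable fun u : unitInterval => u ≤ p := (measurableSet_Iic (a := p)).mem
  have hset : Measurable fun q : S → Prop => {i | q i} := MeasurableEquiv.setOfPred.measurable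
  rw [percolation, setBernoulli_eq_map]
  simp only [Set.mem_univ, ← map_le_volume]
  rw [← Measure.infinitePi_map_pi (fun _ : S => (volume : Measure unitInterval)) fun _ => hm,
    ← Measure.infinitePi_map_restrict' (fun _ : Set (Fin 2 → ℝ) => (volume : Measure unitInterval)),
    Measure.map_map (by fun_prop) (by fun_prop),
    Measure.map_map (hset.comp (by fun_prop)) (by fun_prop)]
  rfl

theorem percolation_real_eq {S : Set (Set (Fin 2 → ℝ))} (hS : S.Finite) (p : unitInterval)
    (E : Set (Set S)) : (percolation S p).real E = uniformLabels.real (openIn S p ⁻¹' E) := by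
  have : Finite S := hS
  rw [percolation_eq_map, map_measureReal_apply (measurable_openIn S p) .of_discrete]

theorem indepFun_openIn {A B : Set (Set (Fin 2 → ℝ))} (hA : A.Finite) (hB : B.Finite)
    (hAB : Disjoint A B) (p : unitInterval) :
    IndepFun (openIn A p) (openIn B p) uniformLabels := by
  have h := (iIndepFun_infinitePi (P := fun _ : Set (Fin 2 → ℝ) => (volume : Measure unitInterval))
    (X := fun _ u => u) fun _ => measurable_id).indepFun_finset hA.toFinset hB.toFinset
    (by simpa using hAB) fun i => measurable_pi_apply i
  have hg : ∀ {A : Set (Set (Fin 2 → ℝ))} (hA : A.Finite),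
      Measurable fun (u : hA.toFinset → unitInterval) =>
        ({s | u ⟨s.1, hA.mem_toFinset.2 s.2⟩ ≤ p} : Set A) := fun hA =>
    measurable_set_iff.2 fun s => (measurableSet_Iic (a := p)).mem.comp (measurable_pi_apply _)
  exact h.comp (hg hA) (hg hB)

theorem uniformLabels_inter {A B : Set (Set (Fin 2 → ℝ))} (hA : A.Finite) (hB : B.Finite)
    (hAB : Disjoint A B) (p : unitInterval) (X : Set (Set A)) (Y : Set (Set B)) :
    uniformLabels.real (openIn A p ⁻¹' X ∩ openIn B p ⁻¹' Y) =
      uniformLabels.real (openIn A p ⁻¹' X) * uniformLabels.real (openIn B p ⁻¹' Y) := by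
  have : Finite A := hA
  have : Finite B := hB
  simp only [measureReal_def]
  rw [(indepFun_openIn hA hB hAB p).measure_inter_preimage_eq_mul _ _ .of_discrete .of_discrete,
    ENNReal.toReal_mul]

theorem uniformLabels_le (s : Set (Fin 2 → ℝ)) (p : unitInterval) :
    uniformLabels.real {U | U s ≤ p} = p := by
  have := (measurePreserving_eval_infinitePi
    (fun _ : Set (Fin 2 → ℝ) => (volume : Measure unitInterval)) s).measureReal_preimage
    (measurableSet_Iic (a := p)).nullMeasurableSet
  have h2 : volume.real (Set.Iic p) = p := by
    rw [measureReal_def, unitInterval.volume_Iic, ENNReal.toReal_ofReal p.2.1]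
  rw [h2] at this
  exact this

theorem uniformLabels_forall_lt (F : Finset (Set (Fin 2 → ℝ))) (p : unitInterval) :
    uniformLabels.real {U | ∀ s ∈ F, p < U s} = (1 - p) ^ F.card := by
  have h : {U : Set (Fin 2 → ℝ) → unitInterval | ∀ s ∈ F, p < U s} =
      Set.pi F fun _ => Set.Ioi p := by
    ext U; simp [Set.pi]
  rw [h, measureReal_def, Measure.infinitePi_pi _ fun _ _ => measurableSet_Ioi]
  simp [unitInterval.volume_Ioi, p.2.2]

/-- Two sets are linked in `O` when a sequence of members of `O`, each meeting the next, joins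
them. -/
def Linked (O : Set (Set (Fin 2 → ℝ))) (s t : Set (Fin 2 → ℝ)) : Prop :=
  ∃ (k : ℕ) (q : ℕ → Set (Fin 2 → ℝ)), q 0 = s ∧ q k = t ∧ (∀ i ≤ k, q i ∈ O) ∧
    ∀ i < k, (q i ∩ q (i + 1)).Nonempty

theorem Linked.mono {O O' : Set (Set (Fin 2 → ℝ))} (h : O ⊆ O') {s t : Set (Fin 2 → ℝ)}
    (hl : Linked O s t) : Linked O' s t := by
  obtain ⟨k, q, h0, hk, hq, hn⟩ := hl
  exact ⟨k, q, h0, hk, fun i hi => h (hq i hi), hn⟩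

theorem Linked.cons {O : Set (Set (Fin 2 → ℝ))} {s t u : Set (Fin 2 → ℝ)}
    (hl : Linked O s t) (hu : u ∈ O) (hus : (u ∩ s).Nonempty) : Linked O u t := by
  obtain ⟨k, q, rfl, hk, hq, hn⟩ := hl
  refine ⟨k + 1, fun i => Nat.casesOn i u q, rfl, hk, fun i hi => ?_, fun i hi => ?_⟩
  · cases i
    exacts [hu, hq _ (by omega)]
  · cases i
    exacts [hus, hn _ (by omega)]

theorem Linked.right_mem {O : Set (Set (Fin 2 → ℝ))} {s t : Set (Fin 2 → ℝ)}
    (hl : Linked O s t) : t ∈ O := by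
  obtain ⟨k, q, -, rfl, hq, -⟩ := hl
  exact hq k le_rfl

theorem Linked.left_mem {O : Set (Set (Fin 2 → ℝ))} {s t : Set (Fin 2 → ℝ)}
    (hl : Linked O s t) : s ∈ O := by
  obtain ⟨k, q, rfl, -, hq, -⟩ := hl
  exact hq 0 (Nat.zero_le k)

theorem openConnected_iff_linked {S : Set (Set (Fin 2 → ℝ))} {ω : Set S} {s t : S} :
    OpenConnected S ω s t ↔ Linked (Subtype.val '' ω) s t := by
  rw [openConnected_iff]
  constructor
  · rintro ⟨k, q, rfl, rfl, hq, hn⟩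
    exact ⟨k, fun i => q i, rfl, rfl, fun i hi => ⟨q i, hq i hi, rfl⟩, hn⟩
  · rintro ⟨k, q, h0, hk, hq, hn⟩
    have : Nonempty S := ⟨s⟩
    choose! q' hq' using hq
    refine ⟨k, fun i => if i ≤ k then q' i else s, ?_, ?_, fun i hi => ?_, fun i hi => ?_⟩
    · exact Subtype.ext (by simp [(hq' 0 (Nat.zero_le k)).2, h0])
    · exact Subtype.ext (by simp [(hq' k le_rfl).2, hk])
    · simpa [hi] using (hq' i hi).1
    · simpa [hi.le, Nat.succ_le_of_lt hi, (hq' i hi.le).2, (hq' (i + 1) hi).2] using hn i hi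

theorem val_image_openIn (S : Set (Set (Fin 2 → ℝ))) (p : unitInterval)
    (U : Set (Fin 2 → ℝ) → unitInterval) :
    Subtype.val '' openIn S p U = {s | s ∈ S ∧ U s ≤ p} := by
  ext s
  simp [openIn, and_comm]

/-- Monotonicity in `p` of the probability of a crossing. -/
theorem percolation_topBottomCrossing_mono {S : Set (Set (Fin 2 → ℝ))} (hS : S.Finite)
    {p q : unitInterval} (hpq : p ≤ q) :
    (percolation S p).real (topBottomCrossing S) ≤
      (percolation S q).real (topBottomCrossing S) := by
  rw [percolation_real_eq hS, percolation_real_eq hS]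
  refine measureReal_mono fun U hU => ?_
  obtain ⟨s, t, hs, ht, hc⟩ := hU
  refine ⟨s, t, hs, ht, ?_⟩
  rw [openConnected_iff_linked, val_image_openIn] at hc ⊢
  refine Linked.mono (fun u hu => ?_) hc
  exact ⟨hu.1, hu.2.trans hpq⟩

/-- The supremum of the diameters is positive because `s₀` belongs to the packing, so it may be
replaced by any upper bound. -/
theorem IsPercolationConstant.connectedToDist_le {p : unitInterval} (hp : IsPercolationConstant p)
    {S : Set (Set (Fin 2 → ℝ))} (hS : IsSquarePacking S) (s₀ : S) {δ : ℝ}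
    (hδ : ∀ s ∈ S, Metric.diam s ≤ δ) {r : ℝ} (hr : 0 < r) :
    (percolation S p).real (connectedToDist S s₀ r) ≤ Real.exp (-(r / δ)) := by
  have hb : BddAbove (Metric.diam '' S) := ⟨δ, by rintro _ ⟨s, hs, rfl⟩; exact hδ s hs⟩
  have hpos : 0 < Metric.diam s₀.1 := by
    obtain ⟨x, ρ, hρ, hx⟩ := (hS.isSquare _ s₀.2).exists_eq_closedBall
    rw [hx, Metric.diam_closedBall_eq _ hρ.le]
    positivity
  have h1 : 0 < sSup (Metric.diam '' S) := hpos.trans_le (le_csSup hb ⟨s₀, s₀.2, rfl⟩)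
  have h2 : sSup (Metric.diam '' S) ≤ δ :=
    csSup_le ⟨_, s₀, s₀.2, rfl⟩ (by rintro _ ⟨s, hs, rfl⟩; exact hδ s hs)
  refine ((hp.2 S hS s₀).2 hb r hr).trans ?_
  gcongr

/-! ### Rows of squares and an upper bound for percolation constants -/

/-- The `i`-th square of side `l` in the row with bottom side at height `h`. -/
def rowSquare (l h : ℝ) (i : ℕ) : Set (Fin 2 → ℝ) :=
  Metric.closedBall ![i * l + l / 2, h + l / 2] (l / 2)

theorem isSquare_closedBall (x : Fin 2 → ℝ) {ρ : ℝ} (hρ : 0 < ρ) :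
    IsSquare (Metric.closedBall x ρ) := by
  refine ⟨fun i => x i - ρ, 2 * ρ, by positivity, ?_⟩
  ext y
  rw [Metric.mem_closedBall, dist_pi_le_iff hρ.le, Set.mem_Icc, Pi.le_def, Pi.le_def,
    ← forall_and]
  refine forall_congr' fun i => ?_
  rw [Real.dist_eq, abs_le]
  constructor <;> rintro ⟨h1, h2⟩ <;> constructor <;> linarith

theorem mem_rowSquare {l : ℝ} (hl : 0 < l) (h : ℝ) (i : ℕ) {y : Fin 2 → ℝ} :
    y ∈ rowSquare l h i ↔
    (i * l ≤ y 0 ∧ y 0 ≤ (i + 1) * l) ∧ h ≤ y 1 ∧ y 1 ≤ h + l := by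
  rw [rowSquare, Metric.mem_closedBall, dist_pi_le_iff (by positivity), Fin.forall_fin_two]
  simp only [Real.dist_eq, abs_le, Matrix.cons_val_zero, Matrix.cons_val_one]
  constructor
  · rintro ⟨⟨h1, h2⟩, h3, h4⟩
    refine ⟨⟨?_, ?_⟩, ?_, ?_⟩ <;> linarith
  · rintro ⟨⟨h1, h2⟩, h3, h4⟩
    refine ⟨⟨?_, ?_⟩, ?_, ?_⟩ <;> linarith

theorem of_mem_interior_rowSquare {l : ℝ} (hl : 0 < l) (h : ℝ) (i : ℕ) {y : Fin 2 → ℝ}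
    (hy : y ∈ interior (rowSquare l h i)) :
    (i * l < y 0 ∧ y 0 < (i + 1) * l) ∧ h < y 1 := by
  rw [rowSquare, interior_closedBall _ (by positivity), Metric.mem_ball,
    dist_pi_lt_iff (by positivity), Fin.forall_fin_two] at hy
  simp only [Real.dist_eq, abs_lt, Matrix.cons_val_zero, Matrix.cons_val_one] at hy
  obtain ⟨⟨h1, h2⟩, h3, h4⟩ := hy
  refine ⟨⟨?_, ?_⟩, ?_⟩ <;> linarith

theorem diam_rowSquare {l : ℝ} (hl : 0 < l) (h : ℝ) (i : ℕ) :
    Metric.diam (rowSquare l h i) = l := by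
  rw [rowSquare, Metric.diam_closedBall_eq _ (by positivity)]; ring

theorem isSquare_rowSquare {l : ℝ} (hl : 0 < l) (h : ℝ) (i : ℕ) :
    IsSquare (rowSquare l h i) := isSquare_closedBall _ (by positivity)

theorem disjoint_interior_rowSquare {l : ℝ} (hl : 0 < l) (h : ℝ) {i j : ℕ}
    (hij : i ≠ j) :
    Disjoint (interior (rowSquare l h i)) (interior (rowSquare l h j)) := by
  rw [Set.disjoint_left]
  intro y hi hj
  obtain ⟨⟨h1, h2⟩, -⟩ := of_mem_interior_rowSquare hl h i hi
  obtain ⟨⟨h3, h4⟩, -⟩ := of_mem_interior_rowSquare hl h j hj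
  have h5 : (i : ℝ) < j + 1 := lt_of_mul_lt_mul_right (h1.trans h4) hl.le
  have h6 : (j : ℝ) < i + 1 := lt_of_mul_lt_mul_right (h3.trans h2) hl.le
  norm_cast at h5 h6
  omega

theorem isSquarePacking_row {l : ℝ} (hl : 0 < l) (h : ℝ) (N : ℕ) :
    IsSquarePacking (rowSquare l h '' Set.Iio N) where
  countable := ((Set.finite_Iio N).image _).countable
  isSquare := by rintro _ ⟨i, -, rfl⟩; exact isSquare_rowSquare hl h i
  disjoint_interior := by
    rintro _ ⟨i, -, rfl⟩ _ ⟨j, -, rfl⟩ hij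
    exact disjoint_interior_rowSquare hl h fun he => hij (he ▸ rfl)

theorem le_setDist {s t : Set (Fin 2 → ℝ)} (hs : s.Nonempty) (ht : t.Nonempty) {r : ℝ}
    (h : ∀ x ∈ s, ∀ y ∈ t, r ≤ dist x y) : r ≤ setDist s t := by
  obtain ⟨x, hx⟩ := hs
  obtain ⟨y, hy⟩ := ht
  refine le_csInf ⟨_, x, hx, y, hy, rfl⟩ ?_
  rintro _ ⟨x, hx, y, hy, rfl⟩
  exact h x hx y hy

theorem IsSquare.nonempty {s : Set (Fin 2 → ℝ)} (h : IsSquare s) : s.Nonempty := by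
  obtain ⟨x, ρ, hρ, rfl⟩ := h.exists_eq_closedBall
  exact ⟨x, Metric.mem_closedBall_self hρ.le⟩

/-- In a row of three unit squares the outer two are at distance 1, so the decay forces `p ^ 3 ≤ exp
(-1) < (3 / 4) ^ 3`. This keeps the probability of a closed square away from 0. -/
theorem IsPercolationConstant.le_three_quarters {p : unitInterval} (hp : IsPercolationConstant p) :
    (p : ℝ) ≤ 3 / 4 := by
  classical
  set S := rowSquare 1 0 '' Set.Iio 3
  let s : Fin 3 → S := fun i => ⟨rowSquare 1 0 i, i, i.2, rfl⟩
  have hle := hp.connectedToDist_le (isSquarePacking_row one_pos 0 3) (s 0) (δ := 1)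
    (by rintro _ ⟨i, -, rfl⟩; exact (diam_rowSquare one_pos 0 i).le) one_pos
  have hsub : {ω : Set S | ∀ u ∈ Finset.univ.image s, u ∈ ω} ⊆ connectedToDist S (s 0) 1 := by
    intro ω hω
    have hs : ∀ i, s i ∈ ω := fun i => hω _ (Finset.mem_image_of_mem _ (Finset.mem_univ i))
    refine ⟨s 2, ?_, ?_⟩
    · refine le_setDist (isSquare_rowSquare one_pos 0 _).nonempty
        (isSquare_rowSquare one_pos 0 _).nonempty fun x hx y hy => ?_
      have h1 := ((mem_rowSquare one_pos 0 _).1 hx).1.2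
      have h2 := ((mem_rowSquare one_pos 0 _).1 hy).1.1
      have h3 := dist_le_pi_dist x y 0
      rw [dist_comm, Real.dist_eq] at h3
      have h4 := le_abs_self (y 0 - x 0)
      norm_num at h1 h2
      linarith
    · refine openConnected_iff.2 ⟨2, fun i => if i = 0 then s 0 else if i = 1 then s 1 else s 2,
        rfl, rfl, fun i _ => ?_, fun i hi => ?_⟩
      · dsimp only; split_ifs
        exacts [hs 0, hs 1, hs 2]
      · interval_cases i
        · refine ⟨![1, 0], (mem_rowSquare one_pos 0 _).2 ?_, (mem_rowSquare one_pos 0 _).2 ?_⟩ <;>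
            norm_num
        · refine ⟨![2, 0], (mem_rowSquare one_pos 0 _).2 ?_, (mem_rowSquare one_pos 0 _).2 ?_⟩ <;>
            norm_num
  have h1 : (p : ℝ) ^ 3 ≤ (percolation S p).real (connectedToDist S (s 0) 1) := by
    refine le_trans ?_ (measureReal_mono hsub)
    rw [measureReal_def, percolation_forall_mem, ENNReal.toReal_pow, ENNReal.toReal_ofReal p.2.1]
    exact pow_le_pow_of_le_one p.2.1 p.2.2 
      (by simpa using Finset.card_image_le (s := Finset.univ) (f := s))
  have h2 := Real.exp_neg_one_lt_d9
  by_contra! h3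
  have h4 : (3 / 4 : ℝ) ^ 3 < (p : ℝ) ^ 3 := by gcongr
  norm_num at hle h4
  norm_num at h2
  linarith

end SquarePercolation

/-! ### Crossings of the unit square -/

namespace SquarePercolation

open MeasureTheory ProbabilityTheory
open scoped ENNReal

/-- The labellings for which members of `T` with labels at most `p` link a set that meets `A` to a
set that meets the line at height `0`. -/
def crossingFrom (T : Set (Set (Fin 2 → ℝ))) (p : unitInterval) (A : Set (Fin 2 → ℝ)) :
    Set (Set (Fin 2 → ℝ) → unitInterval) :=
  {U | ∃ s t, (s ∩ A).Nonempty ∧ (∃ y ∈ t, y 1 = 0) ∧ Linked {u | u ∈ T ∧ U u ≤ p} s t}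

theorem crossingFrom_eq_preimage (T : Set (Set (Fin 2 → ℝ))) (p : unitInterval)
    (A : Set (Fin 2 → ℝ)) : crossingFrom T p A = openIn T p ⁻¹'
      {ω | ∃ s t, (s ∩ A).Nonempty ∧ (∃ y ∈ t, y 1 = 0) ∧ Linked (Subtype.val '' ω) s t} := by
  ext U
  simp only [crossingFrom, Set.mem_preimage, Set.mem_ofPred_eq, val_image_openIn]

/-- At most `n ^ 2` members of a packing in the unit square have diameter at least `1 / n`. -/
theorem card_le_sq {n : ℕ} (hn : 0 < n) (L : Finset (Set (Fin 2 → ℝ)))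
    (hL : IsSquarePacking (L : Set (Set (Fin 2 → ℝ)))) (hsub : ∀ s ∈ L, s ⊆ unitSquare)
    (hd : ∀ s ∈ L, 1 / (n : ℝ) ≤ Metric.diam s) : L.card ≤ n ^ 2 := by
  have hvol : ∀ s ∈ L, ENNReal.ofReal ((1 / n) ^ 2) ≤ volume (interior s) := by
    intro s hs
    obtain ⟨x, ρ, hρ, rfl⟩ := (hL.isSquare s hs).exists_eq_closedBall
    have h1 := hd _ hs
    rw [Metric.diam_closedBall_eq _ hρ.le] at h1
    rw [interior_closedBall _ hρ.ne', Real.volume_pi_ball _ hρ, Fintype.card_fin]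
    gcongr
  have h1 : ∑ s ∈ L, volume (interior s) ≤ 1 := by
    rw [← measure_biUnion_finset (fun s hs t ht hst => hL.disjoint_interior hs ht hst)
      fun s _ => isOpen_interior.measurableSet]
    calc _ ≤ volume unitSquare :=
          measure_mono (Set.iUnion₂_subset fun s hs => interior_subset.trans (hsub s hs))
      _ = 1 := by simp [unitSquare, Real.volume_Icc_pi]
  have h2 : (L.card : ℝ≥0∞) * ENNReal.ofReal ((1 / n) ^ 2) ≤ 1 := by
    refine le_trans ?_ h1
    rw [← nsmul_eq_mul]
    exact Finset.card_nsmul_le_sum _ _ _ hvol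
  have hn' : (0 : ℝ) < n := by exact_mod_cast hn
  rw [← ENNReal.ofReal_natCast, ← ENNReal.ofReal_mul (by positivity), ENNReal.ofReal_le_one,
    one_div, inv_pow, ← div_eq_mul_inv, div_le_one (by positivity)] at h2
  exact_mod_cast h2

/-- Adding a row of squares on top of a packing in the unit square. -/
theorem IsSquarePacking.union_row {T : Set (Set (Fin 2 → ℝ))} (hT : IsSquarePacking T)
    (hsub : ∀ s ∈ T, s ⊆ unitSquare) {l : ℝ} (hl : 0 < l) (N : ℕ) :
    IsSquarePacking (T ∪ rowSquare l 1 '' Set.Iio N) := by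
  have hR := isSquarePacking_row hl 1 N
  have hTR : ∀ s ∈ T, ∀ t ∈ rowSquare l 1 '' Set.Iio N, Disjoint (interior s) (interior t) := by
    rintro s hs _ ⟨i, -, rfl⟩
    rw [Set.disjoint_left]
    intro y hy hy'
    have h1 := (hsub s hs (interior_subset hy)).2 1
    have h2 := (of_mem_interior_rowSquare hl 1 i hy').2
    simp only [Pi.one_apply] at h1
    linarith
  refine ⟨hT.countable.union hR.countable, ?_, ?_⟩
  · rintro s (hs | hs)
    exacts [hT.isSquare s hs, hR.isSquare s hs]
  · rintro s (hs | hs) t (ht | ht) hst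
    exacts [hT.disjoint_interior hs ht hst, hTR s hs t ht, (hTR t ht s hs).symm,
      hR.disjoint_interior hs ht hst]

/-- The square `Q` lies above the unit square and its label is independent of those of `T`. If `Q`
is open and a crossing starts at it, then `Q` is connected to distance `1 / 2`: the last square lies
below height `1 / n ≤ 1 / 2`. The decay is applied with `r = 1 / 2` and diameters at most `1 / n`.
-/
theorem uniformLabels_crossingFrom_rowSquare_le {p : unitInterval} (hp : IsPercolationConstant p)
    {n : ℕ} (hn : 2 ≤ n) {T : Set (Set (Fin 2 → ℝ))} (hT : IsSquarePacking T) (hfin : T.Finite)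
    (hsub : ∀ s ∈ T, s ⊆ unitSquare) (hd : ∀ s ∈ T, Metric.diam s ≤ 1 / n) {i : ℕ} (hi : i ≤ n) :
    p * uniformLabels.real (crossingFrom T p (rowSquare (1 / n) 1 i)) ≤
      Real.exp (-(n / 2)) := by
  have hn₂ : (2 : ℝ) ≤ n := by exact_mod_cast hn
  have hl : (0 : ℝ) < 1 / n := by positivity
  set Q := rowSquare (1 / n : ℝ) 1 i with hQ
  set V := T ∪ rowSquare (1 / n : ℝ) 1 '' Set.Iio (n + 1) with hVdef
  have hV : IsSquarePacking V := hT.union_row hsub hl (n + 1)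
  have hVfin : V.Finite := hfin.union ((Set.finite_Iio _).image _)
  have hQV : Q ∈ V := Or.inr ⟨i, Nat.lt_succ_of_le hi, rfl⟩
  -- Independence needs `Q` outside `T`; its upper left corner has height `1 + 1 / n`.
  have hQT : Q ∉ T := by
    intro h
    have h1 : (![(i : ℝ) * (1 / n), 1 + 1 / n] : Fin 2 → ℝ) ∈ Q := by
      rw [hQ, mem_rowSquare hl]
      refine ⟨⟨?_, ?_⟩, ?_, ?_⟩ <;> simp [add_mul]
    have h2 := (hsub Q h h1).2 1
    simp only [Matrix.cons_val_one, Pi.one_apply, Matrix.cons_val_fin_one] at h2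
    linarith
  have hdV : ∀ s ∈ V, Metric.diam s ≤ 1 / n := by
    rintro s (hs | ⟨j, -, rfl⟩)
    exacts [hd s hs, (diam_rowSquare hl 1 j).le]
  have hle := hp.connectedToDist_le hV ⟨Q, hQV⟩ hdV (r := 1 / 2) (by norm_num)
  rw [show -((1 : ℝ) / 2 / (1 / n)) = -(n / 2) by field_simp, percolation_real_eq hVfin] at hle
  refine le_trans ?_ hle
  have hQopen : {U : Set (Fin 2 → ℝ) → unitInterval | U Q ≤ p} =
      openIn {Q} p ⁻¹' {ω | (⟨Q, rfl⟩ : ({Q} : Set (Set (Fin 2 → ℝ)))) ∈ ω} := by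
    ext U
    simp [openIn]
  calc _ = uniformLabels.real ({U | U Q ≤ p} ∩ crossingFrom T p Q) := by
        rw [← uniformLabels_le Q p, hQopen, crossingFrom_eq_preimage,
          uniformLabels_inter (Set.finite_singleton Q) hfin (by simpa using hQT)]
    _ ≤ _ := by
        refine measureReal_mono ?_
        rintro U ⟨hU, s, t, hsQ, ⟨y, hyt, hy⟩, hst⟩
        have htT : t ∈ T := hst.right_mem.1
        refine ⟨⟨t, Or.inl htT⟩, ?_, ?_⟩
        · refine le_setDist (hV.isSquare Q hQV).nonempty ⟨y, hyt⟩ fun w hw z hz => ?_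
          have h1 := ((mem_rowSquare hl 1 i).1 hw).2.1
          have hb : Bornology.IsBounded t := by
            obtain ⟨x, ρ, -, rfl⟩ := (hT.isSquare t htT).exists_eq_closedBall
            exact Metric.isBounded_closedBall
          have h2 := (dist_le_pi_dist z y 1).trans (Metric.dist_le_diam_of_mem hb hz hyt)
          rw [Real.dist_eq, hy, sub_zero] at h2
          have h3 := dist_le_pi_dist w z 1
          rw [Real.dist_eq] at h3
          have h4 := le_abs_self (w 1 - z 1)
          have h5 := le_abs_self (z 1)
          have h6 := hd t htT
          have h7 : (1 : ℝ) / n ≤ 1 / 2 := one_div_le_one_div_of_le (by norm_num) hn₂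
          linarith
        · rw [openConnected_iff_linked, val_image_openIn]
          refine Linked.cons (Linked.mono (fun u hu => ?_) hst) ⟨hQV, hU⟩ (Set.inter_comm s Q ▸ hsQ)
          exact ⟨Or.inl hu.1, hu.2⟩

theorem uniformLabels_crossing_of_small_le {p : unitInterval} (hp : IsPercolationConstant p)
    {n : ℕ} (hn : 2 ≤ n) (hpn : (n + 1) * Real.exp (-(n / 2)) ≤ p / 2)
    {T : Set (Set (Fin 2 → ℝ))} (hT : IsSquarePacking T) (hfin : T.Finite)
    (hsub : ∀ s ∈ T, s ⊆ unitSquare) (hd : ∀ s ∈ T, Metric.diam s ≤ 1 / n) :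
    uniformLabels.real (crossingFrom T p {x | x 1 = 1}) ≤ 1 / 2 := by
  have hn₀ : (0 : ℝ) < n := by positivity
  have hl : (0 : ℝ) < 1 / n := by positivity
  have hp₀ : (0 : ℝ) < p := hp.1
  have hcover : crossingFrom T p {x | x 1 = 1} ⊆
      ⋃ i ∈ Finset.range (n + 1), crossingFrom T p (rowSquare (1 / n) 1 i) := by
    rintro U ⟨s, t, ⟨x, hxs, hx⟩, ht, hst⟩
    have hxu := hsub s hst.left_mem.1 hxs
    have h0 : 0 ≤ x 0 := hxu.1 0
    have h1 : x 0 ≤ 1 := hxu.2 0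
    -- The value `n` occurs at `x 0 = 1`, which is why the row has `n + 1` squares.
    have hi : ⌊x 0 * n⌋₊ ≤ n :=
      Nat.floor_le_of_le (by nlinarith)
    simp only [Set.mem_iUnion, Finset.mem_range]
    refine ⟨⌊x 0 * n⌋₊, by omega, s, t, ⟨x, hxs, (mem_rowSquare hl 1 _).2 ?_⟩, ht, hst⟩
    have h2 := Nat.floor_le (a := x 0 * n) (by positivity)
    have h3 := (Nat.lt_floor_add_one (x 0 * n)).le
    rw [Set.mem_ofPred_eq] at hx
    refine ⟨⟨?_, ?_⟩, hx.ge, by linarith⟩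
    · rwa [mul_one_div, div_le_iff₀ hn₀]
    · rwa [mul_one_div, le_div_iff₀ hn₀]
  have hterm : ∀ i ∈ Finset.range (n + 1),
      uniformLabels.real (crossingFrom T p (rowSquare (1 / n) 1 i)) ≤
        Real.exp (-(n / 2)) / p := by
    intro i hi
    rw [le_div_iff₀ hp₀, mul_comm]
    exact uniformLabels_crossingFrom_rowSquare_le hp hn hT hfin hsub hd
      (by rw [Finset.mem_range] at hi; omega)
  calc _ ≤ ∑ i ∈ Finset.range (n + 1),
        uniformLabels.real (crossingFrom T p (rowSquare (1 / n) 1 i)) :=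
        (measureReal_mono hcover (measure_ne_top _ _)).trans (measureReal_biUnion_finset_le _ _)
    _ ≤ (n + 1) * (Real.exp (-(n / 2)) / p) := by
        refine (Finset.sum_le_sum hterm).trans ?_
        simp
    _ ≤ 1 / 2 := by
        rw [← mul_div_assoc, div_le_iff₀ hp₀]
        linarith

/-- If all large squares are closed, a crossing uses small squares only. The two events `closed` and
`Cᶜ` concern disjoint sets of labels, so the probability of no crossing is at least `(1 / 4) ^ n ^ 2
* (1 / 2)`. -/
theorem percolation_topBottomCrossing_le {p : unitInterval} (hp : IsPercolationConstant p)
    {n : ℕ} (hn : 2 ≤ n) (hpn : (n + 1) * Real.exp (-(n / 2)) ≤ p / 2)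
    {S : Set (Set (Fin 2 → ℝ))} (hS : IsSquarePacking S) (hfin : S.Finite)
    (hsub : ∀ s ∈ S, s ⊆ unitSquare) :
    (percolation S p).real (topBottomCrossing S) ≤ 1 - (1 / 4) ^ n ^ 2 / 2 := by
  classical
  have hsubpacking : ∀ {T : Set (Set (Fin 2 → ℝ))}, T ⊆ S → IsSquarePacking T := fun h =>
    ⟨hS.countable.mono h, fun s hs => hS.isSquare s (h hs), hS.disjoint_interior.mono h⟩
  set T := {s ∈ S | Metric.diam s ≤ 1 / n} with hTdef
  set L := {s ∈ S | 1 / (n : ℝ) < Metric.diam s} with hLdef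
  have hTS : T ⊆ S := fun s hs => hs.1
  have hLS : L ⊆ S := fun s hs => hs.1
  have hTfin := hfin.subset hTS
  have hLfin := hfin.subset hLS
  have hdisj : Disjoint L T := Set.disjoint_left.2 fun s h1 h2 => h1.2.not_ge h2.2
  have hsmall := uniformLabels_crossing_of_small_le hp hn hpn (hsubpacking hTS) hTfin
    (fun s hs => hsub s hs.1) fun s hs => hs.2
  have hcard : hLfin.toFinset.card ≤ n ^ 2 :=
    card_le_sq (by omega) _ (by simpa using hsubpacking hLS)
      (fun s hs => hsub s (hLfin.mem_toFinset.1 hs).1)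
      fun s hs => (hLfin.mem_toFinset.1 hs).2.le
  set closed := {U : Set (Fin 2 → ℝ) → unitInterval | ∀ s ∈ hLfin.toFinset, p < U s} with hclosed
  have hclosed_eq : closed = openIn L p ⁻¹' {∅} := by
    ext U
    simp [hclosed, openIn, Set.eq_empty_iff_forall_notMem]
  have hclosed_ge : (1 / 4 : ℝ) ^ n ^ 2 ≤ uniformLabels.real closed := by
    rw [hclosed, uniformLabels_forall_lt]
    calc (1 / 4 : ℝ) ^ n ^ 2 ≤ (1 / 4) ^ hLfin.toFinset.card :=
          pow_le_pow_of_le_one (by norm_num) (by norm_num) hcard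
      _ ≤ (1 - p) ^ hLfin.toFinset.card :=
          pow_le_pow_left₀ (by norm_num) (by linarith [hp.le_three_quarters]) _
  set C := crossingFrom T p {x | x 1 = 1} with hC
  have : Finite T := hTfin
  have hCmeas : MeasurableSet C := by
    rw [hC, crossingFrom_eq_preimage]
    exact measurable_openIn T p .of_discrete
  have hind : uniformLabels.real (closed ∩ Cᶜ) =
      uniformLabels.real closed * uniformLabels.real Cᶜ := by
    rw [hclosed_eq, hC, crossingFrom_eq_preimage, ← Set.preimage_compl,
      uniformLabels_inter hLfin hTfin hdisj]
  have hmeas : MeasurableSet (openIn S p ⁻¹' topBottomCrossing S) := by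
    have : Finite S := hfin
    exact measurable_openIn S p .of_discrete
  have hcross : closed ∩ Cᶜ ⊆ (openIn S p ⁻¹' topBottomCrossing S)ᶜ := by
    rintro U ⟨hU, hUC⟩ ⟨s, t, ⟨x, hxs, -, hx⟩, ⟨y, hyt, -, hy⟩, hc⟩
    rw [openConnected_iff_linked, val_image_openIn] at hc
    refine hUC ⟨s, t, ⟨x, hxs, hx⟩, ⟨y, hyt, hy⟩, Linked.mono (fun u hu => ?_) hc⟩
    refine ⟨⟨hu.1, ?_⟩, hu.2⟩
    by_contra! hlarge
    exact (hU u (hLfin.mem_toFinset.2 ⟨hu.1, hlarge⟩)).not_ge hu.2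
  have hmono := measureReal_mono (μ := uniformLabels) hcross
  rw [hind, probReal_compl_eq_one_sub hmeas, probReal_compl_eq_one_sub hCmeas] at hmono
  rw [percolation_real_eq hfin]
  have : (1 / 4 : ℝ) ^ n ^ 2 * (1 / 2) ≤
      uniformLabels.real closed * (1 - uniformLabels.real C) := by
    gcongr
    linarith
  linarith

end SquarePercolation

theorem corollary2p6 :
    (∃ p : unitInterval, SquarePercolation.IsPercolationConstant p) ∧
    ∃ c : ℝ, 0 < c ∧ ∀ p : unitInterval, SquarePercolation.IsPercolationConstant p →
      ∀ S : Set (Set (Fin 2 → ℝ)), SquarePercolation.IsSquarePacking S → S.Finite →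
        (∀ s ∈ S, s ⊆ SquarePercolation.unitSquare) →
        (SquarePercolation.percolation S p).real (SquarePercolation.topBottomCrossing S) ≤
          1 - c := by
  let p₀ : unitInterval := ⟨1 / 200000, by norm_num, by norm_num⟩
  have hp₀ : SquarePercolation.IsPercolationConstant p₀ :=
    SquarePercolation.isPercolationConstant_of_le (Subtype.mk_lt_mk.2 (by norm_num)) le_rfl
  -- The choice `n = 60` works for all `p ≥ p₀`, since `61 * exp (-30) ≤ 61 / 2 ^ 30` is below `1 /
  -- 400000`.
  have hnum : ∀ p : unitInterval, p₀ ≤ p →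
      (((60 : ℕ) : ℝ) + 1) * Real.exp (-((60 : ℕ) / 2)) ≤ p / 2 := by
    intro p hp
    have h1 : (1 / 200000 : ℝ) ≤ p := hp
    have h2 : (2 : ℝ) ^ 30 ≤ Real.exp 30 := by
      have h3 : (2 : ℝ) ≤ Real.exp 1 := by linarith [Real.add_one_le_exp (1 : ℝ)]
      calc (2 : ℝ) ^ 30 ≤ Real.exp 1 ^ 30 := by gcongr
        _ = Real.exp 30 := by rw [← Real.exp_nat_mul]; norm_num
    have h4 : Real.exp (-30) ≤ ((2 : ℝ) ^ 30)⁻¹ := by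
      rw [Real.exp_neg]
      exact inv_anti₀ (by positivity) h2
    norm_num at h4 ⊢
    linarith
  refine ⟨⟨p₀, hp₀⟩, (1 / 4) ^ 60 ^ 2 / 2, by positivity, fun p hp S hS hfin hsub => ?_⟩
  -- A percolation constant may be arbitrarily small, and the required `n` would then grow; below
  -- `p₀` the crossing probability is instead bounded by its value at `p₀`, itself a percolation
  -- constant.
  rcases le_total p₀ p with h | h
  · exact SquarePercolation.percolation_topBottomCrossing_le hp (by norm_num) (hnum p h) hS hfin hsub
  · exact (SquarePercolation.percolation_topBottomCrossing_mono hfin h).trans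
      (SquarePercolation.percolation_topBottomCrossing_le hp₀ (by norm_num) (hnum p₀ le_rfl) hS
        hfin hsub)
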